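/- Let $G$ be a discrete group. A compact $G$-space is a compact Hausdorff space $X$ on which $G$ acts by homeomorphisms. It is a \emph{$G$-boundary} if it is non-empty, the action is minimal (every orbit is dense), and the action is strongly proximal (for every regular Borel probability measure $\nu$ on $X$, the weak* closure of the orbit $G\nu$ contains a point mass $\delta_x$, $x \in X$). The action on $X$ is \emph{topologically free} if for every $s \in G \setminus \{e\}$ the set $\{x \in X \mid sx \neq x\}$ is dense in $X$. The \emph{Furstenberg boundary} $\partial_F G$ is the universal $G$-boundary, i.e. a $G$-boundary such that every $G$-boundary is a continuous $G$-equivariant image of it. Let $\mathrm{C}^*_r(G)$ be the reduced C*-algebra of $G$, generated by the left regular representation on $\ell^2(G)$, and for a compact $G$-space $X$ let $C(X) \rtimes_r G$ be the reduced crossed product. A C*-algebra is \emph{simple} if it is non-zero and its only closed two-sided ideals are $\{0\}$ and the whole algebra. The Furstenberg boundary $\partial_F G$ exists, and the following are equivalent: \begin{enumerate} \item The group $G$ is C*-simple, i.e. the reduced C*-algebra $\mathrm{C}^*_r(G)$ is simple. \item The reduced crossed product $C(\partial_F G) \rtimes_r G$ is simple. \item The reduced crossed product $C(B) \rtimes_r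 G$ is simple for some $G$-boundary $B$. \item The $G$-action on $\partial_F G$ is topologically free. \item The $G$-action on some $G$-boundary is topologically free. \end{enumerate} -/

import Mathlib

open MeasureTheory
open scoped ENNReal

universe u

noncomputable section

/-! ### Compact `G`-spaces, boundaries and the Furstenberg boundary

A compact `G`-space of a discrete group `G` is a compact Hausdorff space `X` on which `G` acts by
homeomorphisms: `[CompactSpace X] [T2Space X] [MulAction G X] [ContinuousConstSMul G X]`. -/

/-- The translate `s ν`, i.e. `(s ν)(Y) = ν (s⁻¹ Y)`, of a Borel probability measure `ν`. -/
def translateProba {G X : Type*} [Group G] [TopologicalSpace X] [MeasurableSpace X] [BorelSpace X]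
    [MulAction G X] [ContinuousConstSMul G X] (s : G) (ν : ProbabilityMeasure X) :
    ProbabilityMeasure X :=
  ν.map (f := fun x => s • x) (continuous_const_smul s).measurable.aemeasurable

/-- The `G`-action on `X` is strongly proximal: the weak* closure of the `G`-orbit of every regular
Borel probability measure contains a point mass. (The topology of `ProbabilityMeasure X` is that of
convergence against continuous functions.) -/
def IsStronglyProximal (G X : Type*) [Group G] [TopologicalSpace X] [MulAction G X]
    [ContinuousConstSMul G X] : Prop :=
  letI : MeasurableSpace X := borel X
  haveI : BorelSpace X := ⟨rfl⟩
  ∀ ν : ProbabilityMeasure X, (ν : Measure X).Regular →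
    ∃ x : X, diracProba x ∈ closure (Set.range fun s : G => translateProba s ν)

/-- A compact `G`-space is a `G`-boundary if it is non-empty, minimal and strongly proximal. -/
structure IsGBoundary (G X : Type*) [Group G] [TopologicalSpace X] [CompactSpace X] [T2Space X]
    [MulAction G X] [ContinuousConstSMul G X] : Prop where
  nonempty : Nonempty X
  minimal : MulAction.IsMinimal G X
  stronglyProximal : IsStronglyProximal G X

/-- `X` is the Furstenberg boundary of `G`, i.e. the universal `G`-boundary: it is a `G`-boundary,
and every `G`-boundary is a continuous `G`-equivariant image of `X`. Every `G`-boundary is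
a quotient of the Stone–Čech compactification `Ultrafilter G` of the discrete space `G`, so
the universe of `G` contains a copy of every `G`-boundary. -/
structure IsFurstenbergBoundary (G X : Type u) [Group G] [TopologicalSpace X] [CompactSpace X]
    [T2Space X] [MulAction G X] [ContinuousConstSMul G X] : Prop where
  isGBoundary : IsGBoundary G X
  universal : ∀ (Y : Type u) [TopologicalSpace Y] [CompactSpace Y] [T2Space Y] [MulAction G Y]
    [ContinuousConstSMul G Y], IsGBoundary G Y →
      ∃ φ : X → Y, Continuous φ ∧ Function.Surjective φ ∧ ∀ (s : G) (x : X), φ (s • x) = s • φ x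

/-- The `G`-action on `X` is topologically free: for `s ≠ 1` the points moved by `s` are dense. -/
def IsTopologicallyFree (G X : Type*) [Group G] [TopologicalSpace X] [MulAction G X] : Prop :=
  ∀ s : G, s ≠ 1 → Dense {x : X | s • x ≠ x}

/-! ### Operators on `ℓ²(ι)` -/

/-- The Hilbert space `ℓ²(ι)`. -/
abbrev EllTwo (ι : Type*) : Type _ := lp (fun _ : ι => ℂ) 2

theorem memEllTwo_perm {ι : Type*} (e : Equiv.Perm ι) (ξ : EllTwo ι) :
    Memℓp (fun i => ξ (e.symm i)) 2 := by
  refine memℓp_gen ?_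
  exact (e.symm.summable_iff (f := fun i => ‖ξ i‖ ^ (2 : ℝ≥0∞).toReal)).2
    ((lp.memℓp ξ).summable (by norm_num))

/-- The unitary operator on `ℓ²(ι)` given by a permutation `e` of `ι`: `ξ ↦ ξ ∘ e⁻¹`. -/
def permOp {ι : Type*} (e : Equiv.Perm ι) : EllTwo ι →L[ℂ] EllTwo ι :=
  LinearMap.mkContinuous
    { toFun := fun ξ => ⟨fun i => ξ (e.symm i), memEllTwo_perm e ξ⟩
      map_add' := fun _ _ => rfl
      map_smul' := fun _ _ => rfl } 1 (by
    intro ξ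
    rw [one_mul, lp.norm_eq_tsum_rpow (by norm_num), lp.norm_eq_tsum_rpow (by norm_num)]
    exact le_of_eq (congrArg (· ^ (1 / (2 : ℝ≥0∞).toReal))
      (e.symm.tsum_eq (fun i => ‖ξ i‖ ^ (2 : ℝ≥0∞).toReal))))

@[simp]
theorem permOp_apply {ι : Type*} (e : Equiv.Perm ι) (ξ : EllTwo ι) (i : ι) :
    permOp e ξ i = ξ (e.symm i) := rfl

theorem memEllTwo_mul {ι : Type*} (φ : ι → ℂ) (C : ℝ) (h : ∀ i, ‖φ i‖ ≤ C) (ξ : EllTwo ι) :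
    Memℓp (fun i => φ i * ξ i) 2 := by
  refine ((lp.memℓp ξ).const_smul (C : ℂ)).mono' fun i => ?_
  rw [norm_mul, Pi.smul_apply, norm_smul, Complex.norm_real]
  exact mul_le_mul_of_nonneg_right ((h i).trans (le_abs_self C)) (norm_nonneg _)

/-- The operator on `ℓ²(ι)` of multiplication by a function `φ` bounded by `C`. -/
def mulOp {ι : Type*} (φ : ι → ℂ) (C : ℝ) (h : ∀ i, ‖φ i‖ ≤ C) : EllTwo ι →L[ℂ] EllTwo ι :=
  LinearMap.mkContinuous
    { toFun := fun ξ => ⟨fun i => φ i * ξ i, memEllTwo_mul φ C h ξ⟩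
      map_add' := fun ξ η => by
        ext i
        exact mul_add (φ i) (ξ i) (η i)
      map_smul' := fun c ξ => by
        ext i
        exact mul_left_comm (φ i) c (ξ i) } |C| (by
    intro ξ
    have h2 : ‖(C : ℂ) • ξ‖ = |C| * ‖ξ‖ := by rw [norm_smul, Complex.norm_real, Real.norm_eq_abs]
    rw [← h2]
    refine lp.norm_mono (by norm_num) fun i => ?_
    change ‖φ i * ξ i‖ ≤ ‖(C : ℂ) * ξ i‖
    rw [norm_mul, norm_mul, Complex.norm_real]
    exact mul_le_mul_of_nonneg_right ((h i).trans (le_abs_self C)) (norm_nonneg _))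

@[simp]
theorem mulOp_apply {ι : Type*} (φ : ι → ℂ) (C : ℝ) (h : ∀ i, ‖φ i‖ ≤ C) (ξ : EllTwo ι) (i : ι) :
    mulOp φ C h ξ i = φ i * ξ i := rfl

/-! ### Reduced group C*-algebras and reduced crossed products -/

/-- The left regular representation of `G` on `ℓ²(G)`: `(λ_s ξ)(t) = ξ(s⁻¹ t)`. -/
def leftRegular (G : Type*) [Group G] (s : G) : EllTwo G →L[ℂ] EllTwo G :=
  permOp (Equiv.mulLeft s)

/-- The reduced C*-algebra of the discrete group `G`: the C*-algebra of operators on `ℓ²(G)`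
generated by the left regular representation. -/
def reducedGroupCStar (G : Type*) [Group G] : StarSubalgebra ℂ (EllTwo G →L[ℂ] EllTwo G) :=
  (StarAlgebra.adjoin ℂ (Set.range (leftRegular G))).topologicalClosure

/-- The unitary `1 ⊗ λ_s` on `ℓ²(G × X) = ℓ²(G, ℓ²(X))`: `(λ_s ξ)(t, x) = ξ(s⁻¹ t, x)`. -/
def crossedUnitary (G X : Type*) [Group G] (s : G) : EllTwo (G × X) →L[ℂ] EllTwo (G × X) :=
  permOp ((Equiv.mulLeft s).prodCongr (Equiv.refl X))

/-- The copy of `f ∈ C(X)` on `ℓ²(G × X) = ℓ²(G, ℓ²(X))`: with `C(X)` faithfully represented on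
`ℓ²(X)` by multiplication, `(f ξ)(t) = (t⁻¹ f) ξ(t)`, and `(t⁻¹ f)(x) = f (t x)`. -/
def crossedFunction (G X : Type*) [Group G] [TopologicalSpace X] [CompactSpace X] [MulAction G X]
    (f : C(X, ℂ)) : EllTwo (G × X) →L[ℂ] EllTwo (G × X) :=
  mulOp (fun p : G × X => f (p.1 • p.2)) ‖f‖ (fun p => f.norm_coe_le_norm (p.1 • p.2))

/-- The reduced crossed product `C(X) ⋊_r G` of a compact `G`-space `X`: the C*-algebra of operators
on `ℓ²(G, ℓ²(X))` generated by the regular representation that is induced by the faithful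
representation of `C(X)` on `ℓ²(X)` by multiplication. -/
def reducedCrossedProduct (G X : Type*) [Group G] [TopologicalSpace X] [CompactSpace X]
    [MulAction G X] : StarSubalgebra ℂ (EllTwo (G × X) →L[ℂ] EllTwo (G × X)) :=
  (StarAlgebra.adjoin ℂ
    (Set.range (crossedFunction G X) ∪ Set.range (crossedUnitary G X))).topologicalClosure

/-- A (unital) C*-algebra is simple if it is non-zero and has no closed two-sided ideals other than
zero and the whole algebra. -/
def IsCStarSimple (A : Type*) [Ring A] [TopologicalSpace A] : Prop :=
  Nontrivial A ∧ ∀ I : TwoSidedIdeal A, IsClosed (I : Set A) → I = ⊥ ∨ I = ⊤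

end

/-!
Strong proximality allows every state of a covariant representation of a boundary to be pushed, by
conjugation with the unitaries of `G`, to states which restrict to a point evaluation on `C(X)`.

If the action is topologically free, such a state at a suitable point vanishes on all the unitaries
`u s` with `s ≠ 1`. A proper ideal is annihilated by some state, hence by one of that form; its
value on `a` is a matrix coefficient of `a` at the unit of `G`, and minimality makes all these
coefficients vanish.

For the converse, `∂_F G` is realised as a minimal closed set of means on `G`, so it carries an
equivariant family of means. By convexity these are limits of equivariant families up to small
errors of vectors of `ℓ²(G)`, and by Fell absorption the representation of `G` on `ℓ²(∂_F G)` is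
weakly contained in the regular one. Simplicity turns the resulting inequality of norms into an
equality, so some state on the operators on `ℓ²(∂_F G)` vanishes on `u s` for all `s ≠ 1`. Pushing
it to a state at a point fixed together with a neighbourhood by some `s ≠ 1` gives a contradiction.
-/

open Filter Topology Set
open scoped CStarAlgebra InnerProductSpace CompactlySupported

noncomputable section

section StateSpace

instance weakDual_locallyConvexSpace {E : Type*} [NormedAddCommGroup E] [NormedSpace ℝ E] :
    LocallyConvexSpace ℝ (WeakDual ℝ E) :=
  WeakBilin.locallyConvexSpace (B := topDualPairing ℝ E)

variable {𝕜 A B : Type*} [RCLike 𝕜] [NormedAddCommGroup A] [NormedSpace 𝕜 A]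
  [NormedAddCommGroup B] [NormedSpace 𝕜 B]

theorem exists_eq_eval_of_weakDual_dual (F : WeakDual 𝕜 A →L[𝕜] 𝕜) :
    ∃ a : A, ∀ φ : WeakDual 𝕜 A, F φ = φ a := by
  obtain ⟨a, ha⟩ := LinearMap.dualEmbedding_surjective (topDualPairing 𝕜 A) F
  exact ⟨a, fun φ => (congrArg (fun F' : WeakDual 𝕜 A →L[𝕜] 𝕜 => F' φ) ha).symm⟩

/-- The transpose of a continuous linear map, as a continuous linear map between weak*-duals. -/
def dualMap (T : A →L[𝕜] B) : WeakDual 𝕜 B →L[𝕜] WeakDual 𝕜 A where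
  toFun φ := StrongDual.toWeakDual (φ.toStrongDual.comp T)
  map_add' _ _ := rfl
  map_smul' _ _ := rfl
  cont := WeakDual.continuous_of_continuous_eval fun a => WeakDual.eval_continuous (T a)

variable [One A]

variable (𝕜 A) in
/-- The states of a unital Banach algebra `A`, with the weak*-topology. For a C*-algebra, and for
`C(X, ℝ)`, the functionals with `‖φ‖ ≤ 1` and `φ 1 = 1` are the positive unital ones. -/
def stateSpace : Set (WeakDual 𝕜 A) := {φ | (∀ a, ‖φ a‖ ≤ ‖a‖) ∧ φ 1 = 1}

theorem isClosed_stateSpace : IsClosed (stateSpace 𝕜 A) := by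
  rw [stateSpace, ofPred_and, ofPred_forall]
  exact (isClosed_iInter fun a => isClosed_le (WeakDual.eval_continuous a).norm
    continuous_const).inter (isClosed_eq (WeakDual.eval_continuous 1) continuous_const)

theorem isCompact_stateSpace : IsCompact (stateSpace 𝕜 A) :=
  (WeakDual.isCompact_closedBall (𝕜 := 𝕜) (E := A) 0 1).of_isClosed_subset isClosed_stateSpace
    fun _ hφ => mem_closedBall_zero_iff.2 <|
      ContinuousLinearMap.opNorm_le_bound _ zero_le_one fun a => (hφ.1 a).trans_eq (one_mul _).symm

instance : CompactSpace (stateSpace 𝕜 A) := isCompact_iff_compactSpace.1 isCompact_stateSpace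

instance : FunLike (stateSpace 𝕜 A) A 𝕜 where
  coe φ := φ.1
  coe_injective _ _ h := Subtype.ext (DFunLike.coe_injective h)

instance : ContinuousLinearMapClass (stateSpace 𝕜 A) 𝕜 A 𝕜 where
  map_add φ := map_add φ.1
  map_smulₛₗ φ := map_smul φ.1
  map_continuous φ := map_continuous φ.1

namespace stateSpace

@[simp]
theorem map_one (φ : stateSpace 𝕜 A) : φ 1 = 1 := φ.2.2

theorem norm_apply_le (φ : stateSpace 𝕜 A) (a : A) : ‖φ a‖ ≤ ‖a‖ := φ.2.1 a

theorem continuous_eval (a : A) : Continuous fun φ : stateSpace 𝕜 A => φ a :=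
  (WeakDual.eval_continuous a).comp continuous_subtype_val

theorem continuous_of_continuous_eval {X : Type*} [TopologicalSpace X] {F : X → stateSpace 𝕜 A}
    (h : ∀ a, Continuous fun x => F x a) : Continuous F :=
  (WeakDual.continuous_of_continuous_eval h).subtype_mk _

end stateSpace

theorem convex_stateSpace {A : Type*} [NormedAddCommGroup A] [NormedSpace ℝ A] [One A] :
    Convex ℝ (stateSpace ℝ A) := by
  rintro φ ⟨hφ, hφ1⟩ ψ ⟨hψ, hψ1⟩ a b ha hb hab
  refine ⟨fun x => ?_, ?_⟩
  · calc ‖a * φ x + b * ψ x‖ ≤ a * ‖φ x‖ + b * ‖ψ x‖ := (norm_add_le _ _).trans_eq <| by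
          rw [norm_mul, norm_mul, Real.norm_of_nonneg ha, Real.norm_of_nonneg hb]
      _ ≤ a * ‖x‖ + b * ‖x‖ := by gcongr <;> apply_assumption
      _ = ‖x‖ := by rw [← add_mul, hab, one_mul]
  · change a * φ 1 + b * ψ 1 = 1
    rw [hφ1, hψ1, mul_one, mul_one, hab]

end StateSpace

section RadonProba

variable {X Y : Type*} [TopologicalSpace X] [CompactSpace X] [TopologicalSpace Y]
  [CompactSpace Y]

variable (X) in
/-- The compact space `P(X)` of regular Borel probability measures on the compact Hausdorff space
`X`, encoded through the Riesz representation theorem as the states of `C(X, ℝ)`. -/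
abbrev RadonProba : Type _ := stateSpace ℝ C(X, ℝ)

namespace RadonProba

theorem nonneg (μ : RadonProba X) {f : C(X, ℝ)} (hf : 0 ≤ f) : 0 ≤ μ f := by
  have hnorm : ‖‖f‖ • (1 : C(X, ℝ)) - f‖ ≤ ‖f‖ := by
    refine (ContinuousMap.norm_le _ (norm_nonneg f)).2 fun x => ?_
    have h1 : f x ≤ ‖f‖ := f.apply_le_norm x
    have h2 : 0 ≤ f x := hf x
    simp only [ContinuousMap.sub_apply, ContinuousMap.smul_apply, ContinuousMap.one_apply,
      smul_eq_mul, mul_one, Real.norm_eq_abs, abs_le]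
    constructor <;> linarith
  have h := (abs_le.1 ((stateSpace.norm_apply_le μ _).trans hnorm)).2
  rw [map_sub, map_smul, stateSpace.map_one, smul_eq_mul, mul_one] at h
  linarith

theorem mono (μ : RadonProba X) {f g : C(X, ℝ)} (hfg : f ≤ g) : μ f ≤ μ g := by
  have h := μ.nonneg (sub_nonneg.2 hfg)
  rwa [map_sub, sub_nonneg] at h

theorem apply_le (μ : RadonProba X) {f : C(X, ℝ)} {c : ℝ} (hf : ∀ x, f x ≤ c) : μ f ≤ c := by
  have h : μ f ≤ μ (c • (1 : C(X, ℝ))) := μ.mono fun x => by simpa using hf x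
  simpa using h

end RadonProba

theorem mem_stateSpace_of_nonneg {φ : WeakDual ℝ C(X, ℝ)} (hφ : ∀ f, 0 ≤ f → 0 ≤ φ f)
    (h1 : φ 1 = 1) : φ ∈ stateSpace ℝ C(X, ℝ) := by
  have hle : ∀ f, φ f ≤ ‖f‖ := fun f => by
    have h := hφ (‖f‖ • 1 - f) fun x => by simpa using f.apply_le_norm x
    rwa [map_sub, map_smul, h1, smul_eq_mul, mul_one, sub_nonneg] at h
  refine ⟨fun f => abs_le.2 ⟨?_, hle f⟩, h1⟩
  have h := hle (-f)
  rw [map_neg, norm_neg] at h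
  linarith

/-- The evaluation `a ↦ (x ↦ ι x a)` along a continuous family `ι` of states. -/
def evalAlong {A : Type*} [NormedAddCommGroup A] [NormedSpace ℝ A] [One A]
    (ι : C(X, stateSpace ℝ A)) : A →L[ℝ] C(X, ℝ) :=
  LinearMap.mkContinuous
    { toFun := fun a => ⟨fun x => ι x a, (stateSpace.continuous_eval a).comp ι.continuous⟩
      map_add' := fun a b => by ext x; exact map_add (ι x) a b
      map_smul' := fun c a => by ext x; exact map_smul (ι x) c a } 1 fun a => by
    rw [one_mul]
    exact (ContinuousMap.norm_le _ (norm_nonneg a)).2 fun x => stateSpace.norm_apply_le (ι x) a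

@[simp]
theorem evalAlong_apply {A : Type*} [NormedAddCommGroup A] [NormedSpace ℝ A] [One A]
    (ι : C(X, stateSpace ℝ A)) (a : A) (x : X) : evalAlong ι a x = ι x a := rfl

theorem dualMap_evalAlong_mem {A : Type*} [NormedAddCommGroup A] [NormedSpace ℝ A] [One A]
    {ι : C(X, stateSpace ℝ A)} {K : Set (WeakDual ℝ A)} (hconv : Convex ℝ K) (hK : IsClosed K)
    (hι : ∀ x, (ι x : WeakDual ℝ A) ∈ K) (μ : RadonProba X) : dualMap (evalAlong ι) μ.1 ∈ K := by
  by_contra hμ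
  obtain ⟨F, c, hFK, hFμ⟩ := geometric_hahn_banach_closed_point hconv hK hμ
  obtain ⟨a, ha⟩ := exists_eq_eval_of_weakDual_dual F
  rw [ha] at hFμ
  exact hFμ.not_ge (μ.apply_le fun x => (ha (ι x) ▸ hFK _ (hι x)).le)

namespace RadonProba

variable (X) in
/-- The embedding of `X` into `P(X)` by point masses. -/
def dirac : C(X, RadonProba X) where
  toFun x := ⟨StrongDual.toWeakDual (ContinuousMap.evalCLM ℝ x),
    fun f => f.norm_coe_le_norm x, rfl⟩
  continuous_toFun := stateSpace.continuous_of_continuous_eval fun f => f.continuous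

@[simp]
theorem dirac_apply (x : X) (f : C(X, ℝ)) : dirac X x f = f x := rfl

theorem dirac_injective [T2Space X] : Function.Injective (dirac X) := fun x y hxy => by
  by_contra hne
  obtain ⟨f, hfx, hfy, -⟩ := exists_continuous_zero_one_of_isClosed
    (isClosed_singleton (x := x)) (isClosed_singleton (x := y)) (by simpa using hne)
  have h : f x = f y := DFunLike.congr_fun hxy f
  exact zero_ne_one ((hfx rfl).symm.trans (h.trans (hfy rfl)))

theorem isClosedEmbedding_dirac [T2Space X] : IsClosedEmbedding (dirac X) :=
  (dirac X).continuous.isClosedEmbedding dirac_injective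

/-- The barycentre of a continuous family `ι` of states with respect to a probability measure. -/
def barycenter {A : Type*} [NormedAddCommGroup A] [NormedSpace ℝ A] [One A]
    (ι : C(X, stateSpace ℝ A)) : C(RadonProba X, stateSpace ℝ A) where
  toFun μ := ⟨dualMap (evalAlong ι) μ.1, dualMap_evalAlong_mem convex_stateSpace
    isClosed_stateSpace (fun x => (ι x).2) μ⟩
  continuous_toFun :=
    stateSpace.continuous_of_continuous_eval fun a => stateSpace.continuous_eval (evalAlong ι a)

/-- The push-forward of probability measures along a continuous map. -/
def map (p : C(X, Y)) : C(RadonProba X, RadonProba Y) := barycenter ((dirac Y).comp p)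

end RadonProba

end RadonProba

section Action

variable {G X Y Z R : Type*} [Group G] [TopologicalSpace X] [MulAction G X]
  [ContinuousConstSMul G X] [TopologicalSpace R]

/-- The translate `x ↦ f (s x)` of a function on a `G`-space. -/
def shift (s : G) (f : C(X, R)) : C(X, R) := f.comp ⟨(s • ·), continuous_const_smul s⟩

@[simp]
theorem shift_apply (s : G) (f : C(X, R)) (x : X) : shift s f x = f (s • x) := rfl

theorem shift_mul (s t : G) (f : C(X, R)) : shift (s * t) f = shift t (shift s f) := by
  ext x
  simp only [shift_apply, mul_smul]

@[simp]
theorem shift_one (f : C(X, R)) : shift (1 : G) f = f := by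
  ext x
  simp only [shift_apply, one_smul]

variable [CompactSpace X] [TopologicalSpace Y] [CompactSpace Y] [MulAction G Y]
  [ContinuousConstSMul G Y] [TopologicalSpace Z] [CompactSpace Z] [MulAction G Z]
  [ContinuousConstSMul G Z]

namespace RadonProba

instance : MulAction G (RadonProba X) where
  smul s μ := map ⟨(s • ·), continuous_const_smul s⟩ μ
  one_smul μ := DFunLike.ext _ _ fun f => congrArg μ (shift_one f)
  mul_smul s t μ := DFunLike.ext _ _ fun f => congrArg μ (shift_mul s t f)

@[simp]
theorem smul_apply (s : G) (μ : RadonProba X) (f : C(X, ℝ)) : (s • μ) f = μ (shift s f) := rfl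

instance : ContinuousConstSMul G (RadonProba X) := ⟨fun _ => (map _).continuous⟩

@[simp]
theorem dirac_smul (s : G) (x : X) : dirac X (s • x) = s • dirac X x := rfl

theorem barycenter_smul {ι : C(X, RadonProba Z)} (hι : ∀ (s : G) x, ι (s • x) = s • ι x) (s : G)
    (μ : RadonProba X) : barycenter ι (s • μ) = s • barycenter ι μ :=
  DFunLike.ext _ _ fun f => congrArg μ <| ContinuousMap.ext fun x => DFunLike.congr_fun (hι s x) f

protected theorem map_smul {p : C(X, Y)} (hp : ∀ (s : G) x, p (s • x) = s • p x) (s : G)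
    (μ : RadonProba X) : map p (s • μ) = s • map p μ :=
  barycenter_smul (fun s x => (congrArg (dirac Y) (hp s x)).trans (dirac_smul s _)) s μ

end RadonProba

end Action

section Proximal

open RadonProba

variable {G X : Type*} [Group G] [TopologicalSpace X] [CompactSpace X] [MulAction G X]
  [ContinuousConstSMul G X]

/-- The point of `P(X)` given by integration against a Borel probability measure. -/
def integralState [MeasurableSpace X] [BorelSpace X] (ν : ProbabilityMeasure X) : RadonProba X :=
  have hint (f : C(X, ℝ)) : Integrable f (ν : Measure X) :=
    (BoundedContinuousFunction.mkOfCompact f).integrable _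
  have hle (f : C(X, ℝ)) : ‖∫ x, f x ∂(ν : Measure X)‖ ≤ ‖f‖ := by
    simpa using norm_integral_le_of_norm_le_const (μ := (ν : Measure X))
      (ae_of_all _ f.norm_coe_le_norm)
  ⟨StrongDual.toWeakDual <| LinearMap.mkContinuous
    { toFun := fun f => ∫ x, f x ∂(ν : Measure X)
      map_add' := fun f g => integral_add (hint f) (hint g)
      map_smul' := fun c f => integral_smul c f } 1 fun f => (hle f).trans_eq (one_mul _).symm,
    hle, by simp [StrongDual.toWeakDual_apply]⟩

section Integral

variable [MeasurableSpace X] [BorelSpace X]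

@[simp]
theorem integralState_apply (ν : ProbabilityMeasure X) (f : C(X, ℝ)) :
    integralState ν f = ∫ x, f x ∂(ν : Measure X) := rfl

theorem isInducing_integralState : IsInducing (integralState (X := X)) := by
  refine isInducing_iff_nhds.2 fun ν => le_antisymm ?_ ?_
  · refine map_le_iff_le_comap.1 (Continuous.tendsto ?_ ν)
    exact stateSpace.continuous_of_continuous_eval fun f =>
      ProbabilityMeasure.continuous_integral_boundedContinuousFunction
        (f := BoundedContinuousFunction.mkOfCompact f)
  · refine tendsto_id'.1 (ProbabilityMeasure.tendsto_iff_forall_integral_tendsto.2 fun f => ?_)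
    exact ((stateSpace.continuous_eval (𝕜 := ℝ) f.toContinuousMap).tendsto _).comp tendsto_comap

theorem integralState_diracProba (x : X) : integralState (diracProba x) = dirac X x :=
  DFunLike.ext _ _ fun f => integral_dirac' _ _ f.continuous.measurable.stronglyMeasurable

theorem integralState_translateProba (s : G) (ν : ProbabilityMeasure X) :
    integralState (translateProba s ν) = s • integralState ν :=
  DFunLike.ext _ _ fun f => by
    rw [integralState_apply, translateProba, ProbabilityMeasure.toMeasure_map,
      integral_map (continuous_const_smul s).measurable.aemeasurable
        f.continuous.measurable.aestronglyMeasurable]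
    rfl

theorem exists_regular_integralState_eq [T2Space X] (μ : RadonProba X) :
    ∃ ν : ProbabilityMeasure X, (ν : Measure X).Regular ∧ integralState ν = μ := by
  let Λ : C_c(X, ℝ) →ₚ[ℝ] ℝ := PositiveLinearMap.mk₀
    { toFun := fun f => μ f.toContinuousMap
      map_add' := fun f g => map_add μ _ _
      map_smul' := fun c f => map_smul μ c _ } fun f hf => μ.nonneg hf
  have hΛ : ∀ f : C(X, ℝ), ∫ x, f x ∂(RealRMK.rieszMeasure Λ) = μ f := fun f =>
    RealRMK.integral_rieszMeasure Λ (CompactlySupportedContinuousMap.continuousMapEquiv f)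
  have : IsFiniteMeasure (RealRMK.rieszMeasure Λ) := ⟨isCompact_univ.measure_lt_top⟩
  have hprob : IsProbabilityMeasure (RealRMK.rieszMeasure Λ) := by
    have hone := hΛ 1
    simp only [ContinuousMap.one_apply, integral_const, smul_eq_mul, mul_one,
      stateSpace.map_one] at hone
    exact ⟨by simpa only [Measure.real, ENNReal.toReal_eq_one_iff] using hone⟩
  exact ⟨⟨_, hprob⟩, RealRMK.regular_rieszMeasure Λ, DFunLike.ext _ _ hΛ⟩

end Integral

theorem isStronglyProximal_iff [T2Space X] : IsStronglyProximal G X ↔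
    ∀ μ : RadonProba X, ∃ x, dirac X x ∈ closure (MulAction.orbit G μ) := by
  let : MeasurableSpace X := borel X
  have : BorelSpace X := ⟨rfl⟩
  have key (ν : ProbabilityMeasure X) (x : X) :
      diracProba x ∈ closure (range fun s : G => translateProba s ν) ↔
        dirac X x ∈ closure (MulAction.orbit G (integralState ν)) := by
    rw [isInducing_integralState.closure_eq_preimage_closure_image, ← range_comp, mem_preimage,
      integralState_diracProba]
    simp only [Function.comp_def, integralState_translateProba]
    rfl
  constructor
  · intro h μ
    obtain ⟨ν, hν, rfl⟩ := exists_regular_integralState_eq μ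
    obtain ⟨x, hx⟩ := h ν hν
    exact ⟨x, (key ν x).1 hx⟩
  · intro h ν _
    obtain ⟨x, hx⟩ := h (integralState ν)
    exact ⟨x, (key ν x).2 hx⟩

theorem IsGBoundary.dirac_mem_closure_orbit [T2Space X] (h : IsGBoundary G X) (μ : RadonProba X)
    (x : X) : dirac X x ∈ closure (MulAction.orbit G μ) := by
  obtain ⟨y, hy⟩ := isStronglyProximal_iff.1 h.stronglyProximal μ
  have hx : x ∈ closure (MulAction.orbit G y) := h.minimal.dense_orbit y x
  refine isClosed_closure.closure_subset (map_mem_closure (dirac X).continuous hx ?_)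
  rintro _ ⟨s, rfl⟩
  change s • dirac X y ∈ closure _
  refine map_mem_closure (continuous_const_smul s) hy ?_
  rintro _ ⟨t, rfl⟩
  exact ⟨s * t, mul_smul s t μ⟩

end Proximal

section MinimalSets

theorem exists_minimal_nonempty_isClosed {V : Type*} [TopologicalSpace V] {P : Set V → Prop}
    (hP : ∀ c : Set (Set V), c.Nonempty → (∀ s ∈ c, P s) → P (⋂₀ c)) {K : Set V}
    (hK : IsCompact K) (hKc : IsClosed K) (hne : K.Nonempty) (hPK : P K) :
    ∃ m ⊆ K, Minimal (fun s => s.Nonempty ∧ IsClosed s ∧ P s) m := by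
  obtain ⟨m, hmK, hm⟩ := zorn_superset_nonempty
    {s : Set V | s ⊆ K ∧ s.Nonempty ∧ IsClosed s ∧ P s} (fun c hc hchain hcne => by
      have : Nonempty c := hcne.to_subtype
      obtain ⟨s₀, hs₀⟩ := hcne
      refine ⟨⋂₀ c, ⟨(sInter_subset_of_mem hs₀).trans (hc hs₀).1, ?_,
        isClosed_sInter fun s hs => (hc hs).2.2.1, hP c ⟨s₀, hs₀⟩ fun s hs => (hc hs).2.2.2⟩,
        fun s hs => sInter_subset_of_mem hs⟩
      exact IsCompact.nonempty_sInter_of_directed_nonempty_isCompact_isClosed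
        (fun a ha b hb => (hchain.total ha hb).elim (fun h => ⟨a, ha, Subset.rfl, h⟩)
          fun h => ⟨b, hb, h, Subset.rfl⟩) (fun s hs => (hc hs).2.1)
        (fun s hs => hK.of_isClosed_subset (hc hs).2.2.1 (hc hs).1) fun s hs => (hc hs).2.2.1)
    K ⟨Subset.rfl, hne, hKc, hPK⟩
  exact ⟨m, hmK, hm.prop.2, fun s hs hsm => hm.le_of_le ⟨hsm.trans hmK, hs⟩ hsm⟩

variable {G V : Type*} [Group G] [TopologicalSpace V] [MulAction G V] [ContinuousConstSMul G V]

theorem surjective_of_equivariant {X : Type*} [TopologicalSpace X] [CompactSpace X] [Nonempty X]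
    [MulAction G X] [T2Space V] [MulAction.IsMinimal G V] {φ : X → V} (hφ : Continuous φ)
    (hs : ∀ (s : G) x, φ (s • x) = s • φ x) : Function.Surjective φ := by
  refine range_eq_univ.1 <| ((isMinimal_iff_isClosed_smul_invariant (M := G)).1 inferInstance _
    (isCompact_range hφ).isClosed ?_).resolve_left (range_nonempty φ).ne_empty
  rintro s _ ⟨_, ⟨x, rfl⟩, rfl⟩
  exact ⟨s • x, hs s x⟩

theorem exists_isMinimal_subset {K : Set V} (hK : IsCompact K) (hKc : IsClosed K)
    (hne : K.Nonempty) (hinv : ∀ (s : G), ∀ v ∈ K, s • v ∈ K) :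
    ∃ S : SubMulAction G V, (S : Set V) ⊆ K ∧ IsCompact (S : Set V) ∧ Nonempty S ∧
      ContinuousConstSMul G S ∧ MulAction.IsMinimal G S := by
  obtain ⟨m, hmK, hm⟩ := exists_minimal_nonempty_isClosed
    (P := fun s : Set V => ∀ (g : G), ∀ v ∈ s, g • v ∈ s)
    (fun c _ hc g v hv s hs => hc s hs g v (hv s hs)) hK hKc hne hinv
  obtain ⟨hmne, hmc, hminv⟩ := hm.prop
  let S : SubMulAction G V := ⟨m, fun g {v} => hminv g v⟩
  have hcont : ContinuousConstSMul G S :=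
    ⟨fun g => (continuous_subtype_val.const_smul g).subtype_mk _⟩
  refine ⟨S, hmK, hK.of_isClosed_subset hmc hmK, hmne.to_subtype, hcont,
    (isMinimal_iff_isClosed_smul_invariant (M := G)).2 fun T hT hTinv => ?_⟩
  refine T.eq_empty_or_nonempty.imp_right fun hTne => eq_univ_of_forall fun x => ?_
  have hle : m ⊆ Subtype.val '' T := hm.le_of_le ⟨hTne.image _,
    (hmc.isClosedEmbedding_subtypeVal.isClosedMap T hT), by
      rintro g _ ⟨y, hy, rfl⟩
      exact ⟨g • y, hTinv g ⟨y, hy, rfl⟩, rfl⟩⟩ (Subtype.coe_image_subset m T)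
  obtain ⟨y, hy, hyx⟩ := hle x.2
  exact Subtype.ext hyx ▸ hy

end MinimalSets

section ExtremePoints

open RadonProba

theorem mem_of_isClosed_ideal_of_forall_ne {𝕜 X : Type*} [RCLike 𝕜] [TopologicalSpace X]
    [CompactSpace X] [T2Space X] {I : Ideal C(X, 𝕜)} (hI : IsClosed (I : Set C(X, 𝕜))) {x : X}
    (h : ∀ y ≠ x, ∃ f ∈ I, f y ≠ 0) {f : C(X, 𝕜)} (hf : f x = 0) : f ∈ I := by
  rw [← ContinuousMap.idealOfSet_ofIdeal_isClosed hI, ContinuousMap.mem_idealOfSet]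
  intro y hy
  by_cases hyx : y = x
  · rwa [hyx]
  · exact absurd (ContinuousMap.mem_setOfIdeal.2 (h y hyx)) hy

theorem exists_forall_mem_isClosed_ideal_eq_zero {𝕜 X : Type*} [RCLike 𝕜] [TopologicalSpace X]
    [CompactSpace X] [T2Space X] {I : Ideal C(X, 𝕜)} (hI : IsClosed (I : Set C(X, 𝕜)))
    (hne : I ≠ ⊤) : ∃ x, ∀ f ∈ I, f x = 0 := by
  by_contra! h
  refine hne (Ideal.eq_top_iff_one I |>.2 ?_)
  rw [← ContinuousMap.idealOfSet_ofIdeal_isClosed hI, ContinuousMap.mem_idealOfSet]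
  exact fun y hy => absurd (ContinuousMap.mem_setOfIdeal.2 (h y)) hy

variable {X A : Type*} [TopologicalSpace X] [CompactSpace X] [NormedAddCommGroup A]
  [NormedSpace ℝ A] [One A]

theorem RadonProba.dualMap_mul_mem_stateSpace (μ : RadonProba X) {h : C(X, ℝ)} (h0 : 0 ≤ h)
    (h1 : μ h = 1) : dualMap (ContinuousLinearMap.mul ℝ C(X, ℝ) h) μ.1 ∈ stateSpace ℝ C(X, ℝ) :=
  mem_stateSpace_of_nonneg (fun f hf => μ.nonneg (f := h * f) (mul_nonneg h0 hf))
    ((congrArg μ (mul_one h)).trans h1)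

variable {ι : C(X, stateSpace ℝ A)} {K : Set (WeakDual ℝ A)} {μ : RadonProba X}

/- `μ` is the average of the measures `(1 ± g) μ`, so extremality forces all three barycentres to
coincide. -/
theorem apply_mul_evalAlong_eq_zero_of_mem_extremePoints (hconv : Convex ℝ K) (hK : IsClosed K)
    (hιK : ∀ x, (ι x : WeakDual ℝ A) ∈ K)
    (hμ : (barycenter ι μ : WeakDual ℝ A) ∈ K.extremePoints ℝ) {g : C(X, ℝ)} (hg : ‖g‖ ≤ 1)
    (hμg : μ g = 0) (a : A) : μ (g * evalAlong ι a) = 0 := by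
  have hb (h : C(X, ℝ)) (h0 : 0 ≤ h) (h1 : μ h = 1) :
      dualMap (evalAlong ι) (dualMap (ContinuousLinearMap.mul ℝ C(X, ℝ) h) μ.1) ∈ K :=
    dualMap_evalAlong_mem hconv hK hιK ⟨_, μ.dualMap_mul_mem_stateSpace h0 h1⟩
  have hgx (x : X) : |g x| ≤ 1 := (g.norm_coe_le_norm x).trans hg
  have hplus := hb (1 + g) (fun x => by simpa using neg_le_iff_add_nonneg'.1 (abs_le.1 (hgx x)).1)
    (by rw [map_add, hμg, stateSpace.map_one, add_zero])
  have hminus := hb (1 - g) (fun x => by simpa using (abs_le.1 (hgx x)).2)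
    (by rw [map_sub, hμg, stateSpace.map_one, sub_zero])
  have hmid : (barycenter ι μ : WeakDual ℝ A) ∈ openSegment ℝ
      (dualMap (evalAlong ι) (dualMap (ContinuousLinearMap.mul ℝ C(X, ℝ) (1 + g)) μ.1))
      (dualMap (evalAlong ι) (dualMap (ContinuousLinearMap.mul ℝ C(X, ℝ) (1 - g)) μ.1)) := by
    refine ⟨1 / 2, 1 / 2, by norm_num, by norm_num, by norm_num, DFunLike.ext _ _ fun a => ?_⟩
    change 1 / 2 * μ ((1 + g) * evalAlong ι a) + 1 / 2 * μ ((1 - g) * evalAlong ι a) =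
      μ (evalAlong ι a)
    rw [add_mul, sub_mul, one_mul, map_add, map_sub]
    ring
  have heq : μ ((1 + g) * evalAlong ι a) = μ (evalAlong ι a) :=
    DFunLike.congr_fun (hμ.2 hplus hminus hmid) a
  rwa [add_mul, one_mul, map_add, add_eq_left] at heq

theorem apply_mul_evalAlong_of_mem_extremePoints (hconv : Convex ℝ K) (hK : IsClosed K)
    (hιK : ∀ x, (ι x : WeakDual ℝ A) ∈ K)
    (hμ : (barycenter ι μ : WeakDual ℝ A) ∈ K.extremePoints ℝ) (g : C(X, ℝ)) (a : A) :
    μ (g * evalAlong ι a) = μ g * μ (evalAlong ι a) := by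
  set g₀ : C(X, ℝ) := g - μ g • 1 with hg₀
  have ht : 0 < ‖g₀‖ + 1 := by positivity
  have h := apply_mul_evalAlong_eq_zero_of_mem_extremePoints hconv hK hιK hμ
    (g := (‖g₀‖ + 1)⁻¹ • g₀)
    (by
      rw [norm_smul, norm_inv, Real.norm_of_nonneg ht.le, inv_mul_le_one₀ ht]
      linarith)
    (by simp only [hg₀, map_smul, map_sub, stateSpace.map_one, smul_eq_mul, mul_one, sub_self,
      mul_zero]) a
  rw [smul_mul_assoc, map_smul, smul_eq_zero_iff_right (inv_ne_zero ht.ne'), hg₀, sub_mul,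
    smul_one_mul, map_sub, map_smul, smul_eq_mul, sub_eq_zero] at h
  exact h

/- Bauer's theorem. The functions `evalAlong ι a - μ (evalAlong ι a)` lie in the closed ideal of
the `f` with `f μ = 0`, and they separate the points of `X`. -/
theorem exists_eq_dirac_of_barycenter_mem_extremePoints [T2Space X] (hι : Function.Injective ι)
    (hconv : Convex ℝ K) (hK : IsClosed K) (hιK : ∀ x, (ι x : WeakDual ℝ A) ∈ K)
    (hμ : (barycenter ι μ : WeakDual ℝ A) ∈ K.extremePoints ℝ) : ∃ x, μ = dirac X x := by
  let I : Ideal C(X, ℝ) :=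
    { carrier := {f | ∀ g, μ (g * f) = 0}
      add_mem' := fun {f₁ f₂} h₁ h₂ g => by rw [mul_add, map_add, h₁ g, h₂ g, add_zero]
      zero_mem' := fun g => by rw [mul_zero, map_zero]
      smul_mem' := fun h f hf g => by rw [smul_eq_mul, ← mul_assoc, hf] }
  have hI : IsClosed (I : Set C(X, ℝ)) := by
    have : (I : Set C(X, ℝ)) = ⋂ g, {f | μ (g * f) = 0} := by ext; simp [I]
    rw [this]
    exact isClosed_iInter fun g => isClosed_eq
      ((map_continuous μ).comp (continuous_const_mul g)) continuous_const
  have hmem (a : A) : evalAlong ι a - μ (evalAlong ι a) • 1 ∈ I := fun g => by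
    rw [mul_sub, mul_smul_one, map_sub, map_smul,
      apply_mul_evalAlong_of_mem_extremePoints hconv hK hιK hμ, smul_eq_mul, mul_comm, sub_self]
  obtain ⟨x, hx⟩ := exists_forall_mem_isClosed_ideal_eq_zero hI fun h => by
    have h1 : μ (1 * 1) = 0 := (Ideal.eq_top_iff_one I).1 h 1
    rw [mul_one, stateSpace.map_one] at h1
    exact one_ne_zero h1
  have hιx (a : A) : ι x a = μ (evalAlong ι a) := by
    simpa [sub_eq_zero] using hx _ (hmem a)
  refine ⟨x, DFunLike.ext _ _ fun f => ?_⟩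
  have hf : f - f x • 1 ∈ I := by
    refine mem_of_isClosed_ideal_of_forall_ne hI (x := x) (fun y hyx => ?_) (by simp)
    obtain ⟨a, ha⟩ := DFunLike.ne_iff.1 (hι.ne hyx)
    exact ⟨_, hmem a, by simpa [sub_eq_zero, ← hιx] using ha⟩
  simpa [sub_eq_zero] using hf 1

/- Milman's converse to the Krein–Milman theorem. If `dirac X x ∉ closure S`, some `d ≥ 0` with
`d x = 0` is bounded away from `0` on the compact set `closure S`, hence on the convex hull. -/
theorem dirac_mem_closure_of_mem_closedConvexHull {S : Set (RadonProba X)} {x : X}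
    (h : (dirac X x).1 ∈ closedConvexHull ℝ (Subtype.val '' S)) : dirac X x ∈ closure S := by
  by_contra hx
  have hcover : closure S ⊆ ⋃ d : {d : C(X, ℝ) // 0 ≤ d ∧ d x = 0}, {μ | 0 < μ d.1} := by
    intro μ hμ
    obtain ⟨f, hf⟩ := DFunLike.ne_iff.1 (ne_of_mem_of_not_mem hμ hx)
    refine mem_iUnion.2 ⟨⟨|f - f x • 1|, abs_nonneg _, by simp⟩, ?_⟩
    have hle : |μ (f - f x • 1)| ≤ μ |f - f x • 1| :=
      abs_le'.2 ⟨μ.mono (le_abs_self _), by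
        rw [← map_neg]
        exact μ.mono (neg_le_abs _)⟩
    refine (abs_pos.2 ?_).trans_le hle
    rw [map_sub, map_smul, stateSpace.map_one, smul_eq_mul, mul_one]
    exact sub_ne_zero.2 hf
  have hdir : Directed (· ⊆ ·) fun d : {d : C(X, ℝ) // 0 ≤ d ∧ d x = 0} =>
      {μ : RadonProba X | 0 < μ d.1} := fun d d' =>
    ⟨⟨d.1 + d'.1, add_nonneg d.2.1 d'.2.1, by simp [d.2.2, d'.2.2]⟩,
      fun μ hμ => (show 0 < μ d.1 from hμ).trans_le (μ.mono (le_add_of_nonneg_right d'.2.1)),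
      fun μ hμ => (show 0 < μ d'.1 from hμ).trans_le (μ.mono (le_add_of_nonneg_left d.2.1))⟩
  have : Nonempty {d : C(X, ℝ) // 0 ≤ d ∧ d x = 0} := ⟨⟨0, le_rfl, rfl⟩⟩
  obtain ⟨d, hd⟩ := isClosed_closure.isCompact.elim_directed_cover
    (fun d : {d : C(X, ℝ) // 0 ≤ d ∧ d x = 0} => {μ : RadonProba X | 0 < μ d.1})
    (fun d => isOpen_lt continuous_const (stateSpace.continuous_eval d.1)) hcover hdir
  obtain ⟨δ, hδ, hSδ⟩ := isClosed_closure.isCompact.exists_forall_le'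
    (stateSpace.continuous_eval d.1).continuousOn hd
  have hhalf : closedConvexHull ℝ (Subtype.val '' S) ⊆ {φ : WeakDual ℝ C(X, ℝ) | δ ≤ φ d.1} :=
    closedConvexHull_min (by
      rintro _ ⟨μ, hμ, rfl⟩
      exact hSδ μ (subset_closure hμ))
      (convex_halfSpace_ge ⟨fun _ _ => rfl, fun _ _ => rfl⟩ δ)
      (isClosed_le continuous_const (WeakDual.eval_continuous _))
  exact hδ.not_ge ((hhalf h).trans_eq d.2.2)

end ExtremePoints

section MinimalConvexSets

open RadonProba

variable {G X Z : Type*} [Group G] [TopologicalSpace Z] [CompactSpace Z] [MulAction G Z]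
  [ContinuousConstSMul G Z] [TopologicalSpace X] [CompactSpace X] [MulAction G X]
  [ContinuousConstSMul G X]

variable (G) in
/-- The `G`-invariant convex sets of probability measures on `Z`, as subsets of the dual space of
`C(Z, ℝ)`. -/
structure IsInvariantConvex (K : Set (WeakDual ℝ C(Z, ℝ))) : Prop where
  subset_stateSpace : K ⊆ stateSpace ℝ C(Z, ℝ)
  convex : Convex ℝ K
  smul_mem (s : G) (μ : RadonProba Z) : μ.1 ∈ K → (s • μ).1 ∈ K

theorem isInvariantConvex_closedConvexHull_orbit (μ : RadonProba Z) :
    IsInvariantConvex G (closedConvexHull ℝ (Subtype.val '' MulAction.orbit G μ)) where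
  subset_stateSpace :=
    closedConvexHull_min (Subtype.coe_image_subset _ _) convex_stateSpace isClosed_stateSpace
  convex := convex_closedConvexHull
  smul_mem s ν hν := by
    let T : WeakDual ℝ C(Z, ℝ) →L[ℝ] WeakDual ℝ C(Z, ℝ) :=
      dualMap (evalAlong ((dirac Z).comp ⟨(s • ·), continuous_const_smul s⟩))
    refine closedConvexHull_min (t := T ⁻¹' closedConvexHull ℝ _) ?_
      (convex_closedConvexHull.linear_preimage T.toLinearMap)
      (isClosed_closedConvexHull.preimage T.continuous) hν
    rintro _ ⟨_, ⟨t, rfl⟩, rfl⟩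
    exact subset_closedConvexHull ⟨s • t • μ, ⟨s * t, mul_smul s t μ⟩, rfl⟩

variable (G Z) in
theorem exists_minimal_isInvariantConvex [Nonempty Z] :
    ∃ K : Set (WeakDual ℝ C(Z, ℝ)),
      Minimal (fun K => K.Nonempty ∧ IsClosed K ∧ IsInvariantConvex G K) K := by
  obtain ⟨z⟩ := ‹Nonempty Z›
  obtain ⟨K, -, hK⟩ := exists_minimal_nonempty_isClosed (P := IsInvariantConvex G)
    (fun c ⟨K₀, hK₀⟩ hc => ⟨(sInter_subset_of_mem hK₀).trans (hc K₀ hK₀).subset_stateSpace,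
      convex_sInter fun K hK => (hc K hK).convex,
      fun s μ hμ K hK => (hc K hK).smul_mem s μ (hμ K hK)⟩)
    isCompact_stateSpace isClosed_stateSpace ⟨_, (dirac Z z).2⟩
    ⟨Subset.rfl, convex_stateSpace, fun s μ _ => (s • μ).2⟩
  exact ⟨K, hK⟩

theorem isStronglyProximal_of_minimal [T2Space X] {K : Set (WeakDual ℝ C(Z, ℝ))}
    (hK : Minimal (fun K => K.Nonempty ∧ IsClosed K ∧ IsInvariantConvex G K) K)
    {ι : C(X, RadonProba Z)} (hι : Function.Injective ι)
    (hequiv : ∀ (s : G) x, ι (s • x) = s • ι x) (hιK : ∀ x, (ι x).1 ∈ K) :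
    IsStronglyProximal G X := by
  obtain ⟨hne, hclosed, hinv⟩ := hK.prop
  refine isStronglyProximal_iff.2 fun μ => ?_
  let P := closedConvexHull ℝ (Subtype.val '' MulAction.orbit G μ)
  have hP : IsInvariantConvex G P := isInvariantConvex_closedConvexHull_orbit μ
  have hKP : K ⊆ dualMap (evalAlong ι) '' P := by
    have horbit : closedConvexHull ℝ (Subtype.val '' MulAction.orbit G (barycenter ι μ)) ⊆
        dualMap (evalAlong ι) '' P := by
      refine closedConvexHull_min ?_
        (hP.convex.linear_image (dualMap (evalAlong ι)).toLinearMap)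
        ((isCompact_stateSpace.of_isClosed_subset isClosed_closedConvexHull
          hP.subset_stateSpace).image (dualMap (evalAlong ι)).continuous).isClosed
      rintro _ ⟨_, ⟨s, rfl⟩, rfl⟩
      exact ⟨_, subset_closedConvexHull ⟨s • μ, ⟨s, rfl⟩, rfl⟩,
        congrArg Subtype.val (barycenter_smul hequiv s μ)⟩
    refine Subset.trans (hK.le_of_le ⟨⟨_, subset_closedConvexHull (mem_image_of_mem _
      (MulAction.mem_orbit_self (M := G) (barycenter ι μ)))⟩, isClosed_closedConvexHull,
      isInvariantConvex_closedConvexHull_orbit _⟩ ?_) horbit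
    refine closedConvexHull_min ?_ hinv.convex hclosed
    rintro _ ⟨_, ⟨s, rfl⟩, rfl⟩
    exact hinv.smul_mem s _ (dualMap_evalAlong_mem hinv.convex hclosed hιK μ)
  obtain ⟨e, he⟩ := (isCompact_stateSpace.of_isClosed_subset hclosed
    hinv.subset_stateSpace).extremePoints_nonempty hne
  obtain ⟨ν, hνP, rfl⟩ := hKP he.1
  obtain ⟨x, hx⟩ := exists_eq_dirac_of_barycenter_mem_extremePoints
    (μ := ⟨ν, hP.subset_stateSpace hνP⟩) hι hinv.convex hclosed hιK he
  exact ⟨x, dirac_mem_closure_of_mem_closedConvexHull (congrArg Subtype.val hx ▸ hνP)⟩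

end MinimalConvexSets

section FurstenbergBoundary

open RadonProba

section Ultrafilter

variable {G : Type*} [Group G]

instance : MulAction G (Ultrafilter G) where
  smul s U := U.map (s * ·)
  one_smul U := by
    change U.map (1 * ·) = U
    simp only [one_mul]
    exact U.map_id
  mul_smul s t U := by
    change U.map (s * t * ·) = (U.map (t * ·)).map (s * ·)
    simp only [Ultrafilter.map_map, Function.comp_def, mul_assoc]

theorem ultrafilter_smul_pure (s t : G) : s • (pure t : Ultrafilter G) = pure (s * t) :=
  Ultrafilter.map_pure _ _

instance : ContinuousConstSMul G (Ultrafilter G) where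
  continuous_const_smul s := by
    refine ultrafilterBasis_is_basis.continuous_iff.2 ?_
    rintro _ ⟨A, rfl⟩
    exact ultrafilter_isOpen_basic ((s * ·) ⁻¹' A)

variable {Y : Type*} [TopologicalSpace Y] [CompactSpace Y] [T2Space Y] [MulAction G Y]

variable (G) in
/-- The extension of the orbit map `g ↦ g y` to the Stone–Čech compactification of `G`. -/
def orbitExtension (y : Y) : C(Ultrafilter G, Y) :=
  ⟨Ultrafilter.extend fun g => g • y, continuous_ultrafilter_extend _⟩

theorem orbitExtension_pure (y : Y) (g : G) : orbitExtension G y (pure g) = g • y :=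
  congrFun (ultrafilter_extend_extends fun g : G => g • y) g

theorem orbitExtension_smul [ContinuousConstSMul G Y] (y : Y) (s : G) (U : Ultrafilter G) :
    orbitExtension G y (s • U) = s • orbitExtension G y U := by
  refine congrFun (denseRange_pure.equalizer
    ((orbitExtension G y).continuous.comp (continuous_const_smul s))
    ((orbitExtension G y).continuous.const_smul s) (funext fun g => ?_)) U
  simp only [Function.comp_apply, Pi.smul_apply, ultrafilter_smul_pure, orbitExtension_pure,
    mul_smul]

end Ultrafilter

section FactorMap

variable {G X Y : Type*} [Group G] [TopologicalSpace X] [CompactSpace X] [MulAction G X]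
  [MulAction.IsMinimal G X] [TopologicalSpace Y] [CompactSpace Y] [T2Space Y]
  [MulAction G Y] [ContinuousConstSMul G Y]

theorem IsGBoundary.forall_mem_range_dirac (hY : IsGBoundary G Y) {Λ : C(X, RadonProba Y)}
    (hΛ : ∀ (s : G) x, Λ (s • x) = s • Λ x) (x : X) : Λ x ∈ range (dirac Y) := by
  obtain ⟨y⟩ := hY.nonempty
  have hcl : closure (MulAction.orbit G (Λ x)) ⊆ range Λ :=
    closure_minimal (by rintro _ ⟨s, rfl⟩; exact ⟨s • x, hΛ s x⟩)
      (isCompact_range Λ.continuous).isClosed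
  obtain ⟨x₀, hx₀⟩ := hcl (hY.dirac_mem_closure_orbit (Λ x) y)
  refine closure_minimal (s := MulAction.orbit G x₀) ?_
    (isClosedEmbedding_dirac.isClosed_range.preimage Λ.continuous) (MulAction.dense_orbit G x₀ x)
  rintro _ ⟨s, rfl⟩
  exact ⟨s • y, by rw [dirac_smul, ← hx₀, hΛ]⟩

theorem IsGBoundary.exists_factor [Nonempty X] (hY : IsGBoundary G Y) {Λ : C(X, RadonProba Y)}
    (hΛ : ∀ (s : G) x, Λ (s • x) = s • Λ x) :
    ∃ φ : X → Y, Continuous φ ∧ Function.Surjective φ ∧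
      ∀ (s : G) (x : X), φ (s • x) = s • φ x := by
  choose φ hφ using hY.forall_mem_range_dirac hΛ
  have := hY.minimal
  have hequiv (s : G) (x : X) : φ (s • x) = s • φ x :=
    dirac_injective (by rw [hφ, hΛ, dirac_smul, hφ])
  have hcont : Continuous φ :=
    isClosedEmbedding_dirac.isInducing.continuous_iff.2 (Λ.continuous.congr fun x => (hφ x).symm)
  exact ⟨φ, hcont, surjective_of_equivariant hcont hequiv, hequiv⟩

end FactorMap

/-- The `G`-set `X` has an equivariant family of means on `G`; these are encoded as the probability
measures on the Stone–Čech compactification of `G`. -/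
def HasEquivariantMeans (G X : Type*) [Group G] [MulAction G X] : Prop :=
  ∃ m : X → RadonProba (Ultrafilter G), ∀ (s : G) (x : X), m (s • x) = s • m x

theorem exists_isFurstenbergBoundary_hasEquivariantMeans (G : Type u) [Group G] :
    ∃ (X : Type u) (_ : TopologicalSpace X) (_ : CompactSpace X) (_ : T2Space X)
      (_ : MulAction G X) (_ : ContinuousConstSMul G X),
      IsFurstenbergBoundary G X ∧ HasEquivariantMeans G X := by
  obtain ⟨K, hK⟩ := exists_minimal_isInvariantConvex G (Ultrafilter G)
  obtain ⟨⟨φ, hφ⟩, hclosed, hinv⟩ := hK.prop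
  have hclosed' : IsClosed {μ : RadonProba (Ultrafilter G) | μ.1 ∈ K} :=
    hclosed.preimage continuous_subtype_val
  obtain ⟨S, hSK, hScomp, hSne, hScont, hSmin⟩ := exists_isMinimal_subset hclosed'.isCompact
    hclosed' ⟨⟨φ, hinv.subset_stateSpace hφ⟩, hφ⟩ hinv.smul_mem
  have : CompactSpace S := isCompact_iff_compactSpace.1 hScomp
  let ι : C(S, RadonProba (Ultrafilter G)) := ⟨Subtype.val, continuous_subtype_val⟩
  refine ⟨S, inferInstance, inferInstance, inferInstance, inferInstance, hScont,
    ⟨⟨hSne, hSmin, isStronglyProximal_of_minimal hK (ι := ι) Subtype.val_injective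
      (fun _ _ => rfl) fun x => hSK x.2⟩, fun Y _ _ _ _ _ hY => ?_⟩, Subtype.val, fun _ _ => rfl⟩
  obtain ⟨y⟩ := hY.nonempty
  exact hY.exists_factor (Λ := (RadonProba.map (orbitExtension G y)).comp ι) fun s x =>
    RadonProba.map_smul (orbitExtension_smul y) s x.1

theorem IsFurstenbergBoundary.hasEquivariantMeans {G X : Type u} [Group G] [TopologicalSpace X]
    [CompactSpace X] [T2Space X] [MulAction G X] [ContinuousConstSMul G X]
    (hX : IsFurstenbergBoundary G X) : HasEquivariantMeans G X := by
  obtain ⟨X₀, _, _, _, _, _, hX₀, m, hm⟩ := exists_isFurstenbergBoundary_hasEquivariantMeans G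
  obtain ⟨r, -, -, hr⟩ := hX.universal X₀ hX₀.isGBoundary
  exact ⟨m ∘ r, fun s x => by rw [Function.comp_apply, hr, hm, Function.comp_apply]⟩

end FurstenbergBoundary

section CovariantRepresentations

/-- A covariant representation of the `G`-space `X` in a C*-algebra `A`: a representation `π` of the
functions on `X` and a unitary representation `u` of `G` with `u s π(f) (u s)⁻¹ = π(f ∘ s⁻¹)`. -/
structure CovRep (G X A : Type*) [Group G] [TopologicalSpace X] [MulAction G X]
    [ContinuousConstSMul G X] [CStarAlgebra A] where
  π : C(X, ℂ) →⋆ₐ[ℂ] A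
  u : G →* A
  star_u (s : G) : star (u s) = u s⁻¹
  cov (s : G) (f : C(X, ℂ)) : u s * π (shift s f) = π f * u s

namespace CovRep

variable {G X A : Type*} [Group G] [TopologicalSpace X] [MulAction G X]
    [ContinuousConstSMul G X] [CStarAlgebra A] (R : CovRep G X A)

/-- The operator `∑ s, π (c s) u s` of a finitely supported `C(X)`-valued function `c` on `G`. -/
def ev : (G →₀ C(X, ℂ)) →ₗ[ℂ] A :=
  Finsupp.lsum ℂ fun s => (LinearMap.mulRight ℂ (R.u s)) ∘ₗ R.π.toAlgHom.toLinearMap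

theorem ev_apply (c : G →₀ C(X, ℂ)) : R.ev c = ∑ s ∈ c.support, R.π (c s) * R.u s := rfl

@[simp]
theorem ev_single (s : G) (f : C(X, ℂ)) : R.ev (Finsupp.single s f) = R.π f * R.u s := by
  rw [ev, Finsupp.lsum_single]
  rfl

theorem u_mul_π (s : G) (f : C(X, ℂ)) : R.u s * R.π f = R.π (shift s⁻¹ f) * R.u s := by
  rw [← R.cov, ← shift_mul, inv_mul_cancel, shift_one]

theorem u_inv_mul_self (s : G) : R.u s⁻¹ * R.u s = 1 := by
  rw [← map_mul, inv_mul_cancel, map_one]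

theorem u_mem_unitary (s : G) : R.u s ∈ unitary A := by
  rw [Unitary.mem_iff, R.star_u, ← map_mul, ← map_mul, inv_mul_cancel, mul_inv_cancel, map_one]
  exact ⟨rfl, rfl⟩

theorem ev_mem_of_mem {S : Submodule ℂ A} (h : ∀ s f, R.π f * R.u s ∈ S) (c : G →₀ C(X, ℂ)) :
    R.ev c ∈ S :=
  Submodule.sum_mem _ fun s _ => h s (c s)

theorem ev_mul_ev_mem_range (c d : G →₀ C(X, ℂ)) : R.ev c * R.ev d ∈ LinearMap.range R.ev := by
  have hmonomial (s f t g) : R.π f * R.u s * (R.π g * R.u t) ∈ LinearMap.range R.ev :=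
    ⟨Finsupp.single (s * t) (f * shift s⁻¹ g), by
      rw [ev_single, map_mul, map_mul, mul_assoc, mul_assoc, ← mul_assoc (R.u s), u_mul_π]
      simp only [mul_assoc]⟩
  have hleft (s f) : R.π f * R.u s * R.ev d ∈ LinearMap.range R.ev :=
    R.ev_mem_of_mem (S := (LinearMap.range R.ev).comap (LinearMap.mulLeft ℂ (R.π f * R.u s)))
      (hmonomial s f) d
  exact R.ev_mem_of_mem (S := (LinearMap.range R.ev).comap (LinearMap.mulRight ℂ (R.ev d)))
    hleft c

theorem star_ev_mem_range (c : G →₀ C(X, ℂ)) : star (R.ev c) ∈ LinearMap.range R.ev := by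
  rw [ev_apply, star_sum]
  exact Submodule.sum_mem _ fun s _ => ⟨Finsupp.single s⁻¹ (shift s (star (c s))), by
    rw [ev_single, star_mul, R.star_u, ← map_star R.π, u_mul_π, inv_inv]⟩

/-- The *-algebra of the operators `∑ s, π (c s) u s`. -/
def alg : StarSubalgebra ℂ A where
  carrier := range R.ev
  mul_mem' := by
    rintro _ _ ⟨c, rfl⟩ ⟨d, rfl⟩
    exact R.ev_mul_ev_mem_range c d
  add_mem' := (LinearMap.range R.ev).add_mem
  algebraMap_mem' r := ⟨Finsupp.single 1 (algebraMap ℂ _ r), by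
    rw [ev_single, map_one, mul_one, AlgHomClass.commutes]⟩
  star_mem' := by
    rintro _ ⟨c, rfl⟩
    exact R.star_ev_mem_range c

theorem π_mem_alg (f : C(X, ℂ)) : R.π f ∈ R.alg := ⟨Finsupp.single 1 f, by simp⟩

theorem u_mem_alg (s : G) : R.u s ∈ R.alg := ⟨Finsupp.single s 1, by simp⟩

theorem adjoin_eq_alg : StarAlgebra.adjoin ℂ (range R.π ∪ range R.u) = R.alg := by
  refine le_antisymm (StarAlgebra.adjoin_le ?_) ?_
  · rintro _ (⟨f, rfl⟩ | ⟨s, rfl⟩)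
    exacts [R.π_mem_alg f, R.u_mem_alg s]
  · rintro _ ⟨c, rfl⟩
    exact sum_mem fun s _ => mul_mem (StarAlgebra.subset_adjoin ℂ _ (Or.inl ⟨_, rfl⟩))
      (StarAlgebra.subset_adjoin ℂ _ (Or.inr ⟨s, rfl⟩))

/-- The C*-algebra that is generated by a covariant representation. -/
def cstar : StarSubalgebra ℂ A := R.alg.topologicalClosure

theorem mem_cstar {a : A} : a ∈ R.cstar ↔ a ∈ closure (range R.ev) := Iff.rfl

theorem isClosed_cstar : IsClosed (R.cstar : Set A) :=
  StarSubalgebra.isClosed_topologicalClosure _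

theorem ev_mem_cstar (c : G →₀ C(X, ℂ)) : R.ev c ∈ R.cstar := subset_closure ⟨c, rfl⟩

/-- The state `a ↦ φ ((u s)⁻¹ a (u s))`. -/
def conj (s : G) (φ : stateSpace ℂ A) : stateSpace ℂ A :=
  ⟨dualMap (ContinuousLinearMap.mul ℂ A (R.u s⁻¹) ∘L (ContinuousLinearMap.mul ℂ A).flip (R.u s))
    φ.1, fun a => (stateSpace.norm_apply_le φ _).trans_eq <| by
      change ‖R.u s⁻¹ * (a * R.u s)‖ = ‖a‖
      rw [CStarRing.norm_mem_unitary_mul _ (R.u_mem_unitary _),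
        CStarRing.norm_mul_mem_unitary _ (R.u_mem_unitary s)], by
    change φ (R.u s⁻¹ * (1 * R.u s)) = 1
    rw [one_mul, R.u_inv_mul_self, stateSpace.map_one]⟩

@[simp]
theorem conj_apply (s : G) (φ : stateSpace ℂ A) (a : A) :
    R.conj s φ a = φ (R.u s⁻¹ * (a * R.u s)) := rfl

/-- The direct sum of two covariant representations. -/
def prod {A' : Type*} [CStarAlgebra A'] (R' : CovRep G X A') : CovRep G X (A × A') where
  π := R.π.prod R'.π
  u := R.u.prod R'.u
  star_u s := Prod.ext (R.star_u s) (R'.star_u s)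
  cov s f := Prod.ext (R.cov s f) (R'.cov s f)

theorem prod_ev {A' : Type*} [CStarAlgebra A'] (R' : CovRep G X A') (c : G →₀ C(X, ℂ)) :
    (R.prod R').ev c = (R.ev c, R'.ev c) :=
  Prod.ext (Prod.fst_sum ..) (Prod.snd_sum ..)

end CovRep

end CovariantRepresentations

section PermutationRepresentations

theorem star_permOp {ι : Type*} (e : Equiv.Perm ι) : star (permOp e) = permOp e.symm := by
  rw [ContinuousLinearMap.star_eq_adjoint, eq_comm, ContinuousLinearMap.eq_adjoint_iff]
  intro x y
  rw [lp.inner_eq_tsum, lp.inner_eq_tsum, ← e.symm.tsum_eq]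
  exact tsum_congr fun i => by simp only [permOp_apply, Equiv.symm_symm, Equiv.apply_symm_apply]

theorem permOp_mem_unitary {ι : Type*} (e : Equiv.Perm ι) :
    permOp e ∈ unitary (EllTwo ι →L[ℂ] EllTwo ι) := by
  rw [Unitary.mem_iff, star_permOp]
  constructor <;> ext ξ i <;> simp [mul_apply_eq_comp]

theorem star_mulOp {ι : Type*} (φ : ι → ℂ) (C : ℝ) (h : ∀ i, ‖φ i‖ ≤ C) :
    star (mulOp φ C h) = mulOp (fun i => star (φ i)) C (fun i => by simpa using h i) := by
  rw [ContinuousLinearMap.star_eq_adjoint, eq_comm, ContinuousLinearMap.eq_adjoint_iff]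
  intro x y
  rw [lp.inner_eq_tsum, lp.inner_eq_tsum]
  refine tsum_congr fun i => ?_
  simp only [mulOp_apply, RCLike.inner_apply, map_mul, RCLike.star_def, RCLike.conj_conj]
  ring

instance EllTwo.instNontrivial {ι : Type*} [Nonempty ι] : Nontrivial (EllTwo ι) := by
  classical
  obtain ⟨i⟩ := ‹Nonempty ι›
  exact ⟨lp.single 2 i 1, 0, fun h => by simpa using congrArg norm h⟩

theorem EllTwo.clm_eq_zero {ι E : Type*} [DecidableEq ι] [NormedAddCommGroup E] [NormedSpace ℂ E]
    {T : EllTwo ι →L[ℂ] E} (h : ∀ i, T (lp.single 2 i 1) = 0) : T = 0 := by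
  ext ξ
  have hsum := (lp.hasSum_single (by norm_num) ξ).mapL T
  have hzero (i : ι) : T (lp.single 2 i (ξ i)) = 0 := by
    have hsmul : lp.single (E := fun _ : ι => ℂ) 2 i (ξ i) = ξ i • lp.single 2 i 1 := by
      rw [← lp.single_smul, smul_eq_mul, mul_one]
    rw [hsmul, map_smul, h, smul_zero]
  simp only [hzero] at hsum
  exact hsum.unique hasSum_zero

variable {G X ι : Type*} [Group G] [TopologicalSpace X] [CompactSpace X] [MulAction G X]
  [ContinuousConstSMul G X]

/-- The covariant representation of `X` on `ℓ²(ι)` that is given by an action `κ` on `ι` and an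
equivariant map `j : ι → X`. -/
def permRep (κ : G →* Equiv.Perm ι) (j : ι → X) (hj : ∀ s i, j (κ s i) = s • j i) :
    CovRep G X (EllTwo ι →L[ℂ] EllTwo ι) where
  π :=
    { toFun := fun f => mulOp (fun i => f (j i)) ‖f‖ (fun i => f.norm_coe_le_norm (j i))
      map_one' := by ext ξ i; simp
      map_mul' := fun f g => by ext ξ i; simp [mul_assoc]
      map_zero' := by ext ξ i; simp
      map_add' := fun f g => by ext ξ i; simp [add_mul]
      commutes' := fun r => by ext ξ i; simp [Algebra.algebraMap_eq_smul_one]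
      map_star' := fun f => by rw [star_mulOp]; ext ξ i; simp }
  u :=
    { toFun := fun s => permOp (κ s)
      map_one' := by rw [map_one]; rfl
      map_mul' := fun s t => by rw [map_mul]; rfl }
  star_u s := (star_permOp _).trans (congrArg permOp (map_inv κ s).symm)
  cov s f := by
    ext ξ i
    change f (s • j ((κ s).symm i)) * ξ ((κ s).symm i) = f (j i) * ξ ((κ s).symm i)
    rw [← hj, Equiv.apply_symm_apply]

section

variable (κ : G →* Equiv.Perm ι) (j : ι → X) (hj : ∀ s i, j (κ s i) = s • j i)

@[simp]
theorem permRep_π_apply (f : C(X, ℂ)) (ξ : EllTwo ι) (i : ι) :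
    (permRep κ j hj).π f ξ i = f (j i) * ξ i := rfl

@[simp]
theorem permRep_u_apply (s : G) (ξ : EllTwo ι) (i : ι) :
    (permRep κ j hj).u s ξ i = ξ (κ s⁻¹ i) := by
  rw [map_inv]
  rfl

theorem permRep_ev_apply (c : G →₀ C(X, ℂ)) (ξ : EllTwo ι) (i : ι) :
    (permRep κ j hj).ev c ξ i = ∑ s ∈ c.support, c s (j i) * ξ (κ s⁻¹ i) := by
  simp only [CovRep.ev_apply, sum_apply, lp.coeFn_sum, Finset.sum_apply, mul_apply_eq_comp,
    permRep_π_apply, permRep_u_apply]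

end

section Diagonal

variable {κ : G →* Equiv.Perm ι} {j : ι → X} {hj : ∀ s i, j (κ s i) = s • j i}

theorem inner_single_permRep_ev [DecidableEq ι] (hκ : ∀ s i, κ s i = i → s = 1)
    (c : G →₀ C(X, ℂ)) (i : ι) :
    ⟪lp.single 2 i 1, (permRep κ j hj).ev c (lp.single 2 i 1)⟫_ℂ = c 1 (j i) := by
  rw [lp.inner_single_left, permRep_ev_apply, Finset.sum_eq_single 1]
  · rw [inv_one, map_one κ, Equiv.Perm.one_apply, lp.single_apply_self, mul_one,
      RCLike.inner_apply, map_one (starRingEnd ℂ), mul_one]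
  · intro s _ hs
    have hne : κ s⁻¹ i ≠ i := fun h => hs (inv_eq_one.1 (hκ _ i h))
    rw [lp.single_apply_ne _ _ _ hne, mul_zero]
  · intro h
    simp [Finsupp.notMem_support_iff.1 h]

theorem norm_apply_one_le_norm_permRep_ev (hκ : ∀ s i, κ s i = i → s = 1) (c : G →₀ C(X, ℂ))
    (i : ι) : ‖c 1 (j i)‖ ≤ ‖(permRep κ j hj).ev c‖ := by
  classical
  set δ : EllTwo ι := lp.single 2 i 1 with hδ
  have hδ1 : ‖δ‖ = 1 := by simp [hδ]
  calc ‖c 1 (j i)‖ = ‖⟪δ, (permRep κ j hj).ev c δ⟫_ℂ‖ := by rw [inner_single_permRep_ev hκ]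
    _ ≤ ‖δ‖ * ‖(permRep κ j hj).ev c δ‖ := norm_inner_le_norm _ _
    _ ≤ ‖(permRep κ j hj).ev c‖ := by
      rw [hδ1, one_mul]
      exact ContinuousLinearMap.unit_le_opNorm _ _ hδ1.le

theorem inner_single_eq_zero_of_mem_cstar [DecidableEq ι] (hκ : ∀ s i, κ s i = i → s = 1)
    {a : EllTwo ι →L[ℂ] EllTwo ι} (ha : a ∈ (permRep κ j hj).cstar)
    (hac : ∀ c : G →₀ C(X, ℂ), ‖c 1‖ ≤ ‖a - (permRep κ j hj).ev c‖) (i : ι) :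
    ⟪lp.single 2 i 1, a (lp.single 2 i 1)⟫_ℂ = 0 := by
  set δ : EllTwo ι := lp.single 2 i 1 with hδ
  have hδ1 : ‖δ‖ = 1 := by simp [hδ]
  refine norm_eq_zero.1 (le_antisymm (le_of_forall_pos_le_add fun ε hε => ?_) (norm_nonneg _))
  obtain ⟨_, ⟨c, rfl⟩, hc⟩ := Metric.mem_closure_iff.1 (CovRep.mem_cstar _ |>.1 ha) (ε / 2)
    (half_pos hε)
  rw [dist_eq_norm] at hc
  calc ‖⟪δ, a δ⟫_ℂ‖ = ‖⟪δ, (a - (permRep κ j hj).ev c) δ⟫_ℂ + c 1 (j i)‖ := by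
        rw [← inner_single_permRep_ev (hj := hj) hκ, ← inner_add_right, ← add_apply, sub_add_cancel]
    _ ≤ ‖a - (permRep κ j hj).ev c‖ + ‖c 1‖ := by
        refine norm_add_le_of_le ((norm_inner_le_norm _ _).trans ?_) ((c 1).norm_coe_le_norm _)
        rw [hδ1, one_mul]
        exact ContinuousLinearMap.unit_le_opNorm _ _ hδ1.le
    _ ≤ 0 + ε := by linarith [hac c]

end Diagonal

variable (G) in
/-- The regular covariant representation on `ℓ²(G)` of the orbit of `x`. -/
def regRep (x : X) : CovRep G X (EllTwo G →L[ℂ] EllTwo G) :=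
  permRep (MulAction.toPermHom G G) (· • x) fun s t => mul_smul s t x

theorem regRep_ev_apply (x : X) (c : G →₀ C(X, ℂ)) (ξ : EllTwo G) (t : G) :
    (regRep G x).ev c ξ t = ∑ s ∈ c.support, c s (t • x) * ξ (s⁻¹ * t) :=
  permRep_ev_apply _ _ _ c ξ t

/-- The action of `G` on `G × Z` by left translations of the first coordinate. -/
def leftPermProd (G Z : Type*) [Group G] : G →* Equiv.Perm (G × Z) where
  toFun s := (Equiv.mulLeft s).prodCongr (Equiv.refl Z)
  map_one' := Equiv.ext fun p => Prod.ext (one_mul p.1) rfl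
  map_mul' s t := Equiv.ext fun p => Prod.ext (mul_assoc s t p.1) rfl

variable {Z : Type*}

variable (G) in
/-- The regular covariant representation on `ℓ²(G × Z) = ℓ²(G, ℓ²(Z))` that is induced by the
representation `f ↦ f ∘ q` of `C(X)` on `ℓ²(Z)`. -/
def inducedRep (q : Z → X) : CovRep G X (EllTwo (G × Z) →L[ℂ] EllTwo (G × Z)) :=
  permRep (leftPermProd G Z) (fun p => p.1 • q p.2) fun s p => mul_smul s p.1 (q p.2)

theorem inducedRep_ev_apply (q : Z → X) (c : G →₀ C(X, ℂ)) (ξ : EllTwo (G × Z)) (p : G × Z) :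
    (inducedRep G q).ev c ξ p = ∑ s ∈ c.support, c s (p.1 • q p.2) * ξ (s⁻¹ * p.1, p.2) :=
  permRep_ev_apply _ _ _ c ξ p

variable (G X) in
theorem reducedCrossedProduct_eq : reducedCrossedProduct G X = (inducedRep G (id : X → X)).cstar :=
  congrArg StarSubalgebra.topologicalClosure (inducedRep G (id : X → X)).adjoin_eq_alg

theorem reducedGroupCStar_le (x : X) : reducedGroupCStar G ≤ (regRep G x).cstar := by
  refine StarSubalgebra.topologicalClosure_mono (StarAlgebra.adjoin_le ?_)
  rintro _ ⟨s, rfl⟩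
  exact (regRep G x).u_mem_alg s

theorem reducedGroupCStar_eq [Subsingleton X] (x : X) :
    reducedGroupCStar G = (regRep G x).cstar := by
  refine le_antisymm (reducedGroupCStar_le x) (StarSubalgebra.topologicalClosure_mono ?_)
  rw [← CovRep.adjoin_eq_alg]
  refine StarAlgebra.adjoin_le ?_
  rintro _ (⟨f, rfl⟩ | ⟨s, rfl⟩)
  · have hf : f = algebraMap ℂ C(X, ℂ) (f x) := by
      ext y
      simp [Subsingleton.elim y x]
    rw [hf, AlgHomClass.commutes]
    exact StarSubalgebra.algebraMap_mem _ _
  · exact StarAlgebra.subset_adjoin ℂ _ ⟨s, rfl⟩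

end PermutationRepresentations

section StatesAtPoints

namespace stateSpace

variable {A : Type*} [CStarAlgebra A]

theorem apply_eq_zero_of_forall_norm_add_smul_sq_le {ψ : stateSpace ℂ A} {a b : A}
    (h1 : (ψ a).re = 1) (h : ∀ z : ℂ, ‖a + z • b‖ ^ 2 ≤ 1 + ‖z • b‖ ^ 2) : ψ b = 0 := by
  by_contra hne
  set b' : A := (ψ b)⁻¹ • b with hb'
  have hψb' : ψ b' = 1 := by rw [map_smul, smul_eq_mul, inv_mul_cancel₀ hne]
  have hgrowth (t : ℝ) (ht : 0 ≤ t) : (1 + t) ^ 2 ≤ 1 + t ^ 2 * ‖b'‖ ^ 2 := by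
    have hre : 1 + t ≤ ‖a + (t : ℂ) • b'‖ := calc
      1 + t = (ψ (a + (t : ℂ) • b')).re := by
        rw [map_add, map_smul, hψb', smul_eq_mul, mul_one, Complex.add_re, h1, Complex.ofReal_re]
      _ ≤ ‖a + (t : ℂ) • b'‖ := (Complex.re_le_norm _).trans (norm_apply_le ψ _)
    have hnorm : ‖(t : ℂ) • b'‖ ^ 2 = t ^ 2 * ‖b'‖ ^ 2 := by
      rw [norm_smul, Complex.norm_real, mul_pow, Real.norm_eq_abs, sq_abs]
    have hz := h ((t : ℂ) * (ψ b)⁻¹)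
    rw [mul_smul, ← hb', hnorm] at hz
    exact (pow_le_pow_left₀ (by positivity) hre 2).trans hz
  have ht : 0 < (‖b'‖ ^ 2 + 1)⁻¹ := by positivity
  have htb : (‖b'‖ ^ 2 + 1)⁻¹ * (‖b'‖ ^ 2 + 1) = 1 := inv_mul_cancel₀ (by positivity)
  nlinarith [hgrowth _ ht.le]

/- If `a* b = 0`, then `‖a + z b‖² ≤ ‖a‖² + ‖z b‖²`, whereas `|ψ (a + z b)|` would grow linearly at
`z = 0`. -/
theorem apply_eq_zero_of_star_mul_eq_zero {ψ : stateSpace ℂ A} {a b : A} (ha : ‖a‖ ≤ 1)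
    (h1 : (ψ a).re = 1) (hab : star a * b = 0) : ψ b = 0 := by
  refine apply_eq_zero_of_forall_norm_add_smul_sq_le h1 fun z => ?_
  have hab' : star b * a = 0 := by rw [← star_star a, ← star_mul, hab, star_zero]
  calc ‖a + z • b‖ ^ 2 = ‖star a * a + star (z • b) * (z • b)‖ := by
        rw [sq, ← CStarRing.norm_star_mul_self, star_add, star_smul, add_mul, mul_add, mul_add,
          mul_smul_comm, hab, smul_mul_assoc _ _ a, hab', smul_zero, smul_zero, add_zero, zero_add]
    _ ≤ ‖star a * a‖ + ‖star (z • b) * (z • b)‖ := norm_add_le _ _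
    _ = ‖a‖ ^ 2 + ‖z • b‖ ^ 2 := by
        rw [CStarRing.norm_star_mul_self, CStarRing.norm_star_mul_self, sq, sq]
    _ ≤ 1 + ‖z • b‖ ^ 2 := by gcongr; exact pow_le_one₀ (norm_nonneg a) ha

theorem apply_eq_zero_of_mul_star_eq_zero {ψ : stateSpace ℂ A} {a b : A} (ha : ‖a‖ ≤ 1)
    (h1 : (ψ a).re = 1) (hab : a * star b = 0) : ψ b = 0 := by
  refine apply_eq_zero_of_forall_norm_add_smul_sq_le h1 fun z => ?_
  have hab' : b * star a = 0 := by rw [← star_star b, ← star_mul, hab, star_zero]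
  calc ‖a + z • b‖ ^ 2 = ‖a * star a + (z • b) * star (z • b)‖ := by
        rw [sq, ← CStarRing.norm_self_mul_star, star_add, star_smul, add_mul, mul_add, mul_add,
          mul_smul_comm, hab, smul_mul_assoc _ _ (star a), hab', smul_zero, smul_zero, add_zero,
          zero_add]
    _ ≤ ‖a * star a‖ + ‖(z • b) * star (z • b)‖ := norm_add_le _ _
    _ = ‖a‖ ^ 2 + ‖z • b‖ ^ 2 := by
        rw [CStarRing.norm_self_mul_star, CStarRing.norm_self_mul_star, sq, sq]
    _ ≤ 1 + ‖z • b‖ ^ 2 := by gcongr; exact pow_le_one₀ (norm_nonneg a) ha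

end stateSpace

/-- The inclusion of the real functions into the complex functions. -/
def toComplex (X : Type*) [TopologicalSpace X] : C(X, ℝ) →L[ℝ] C(X, ℂ) :=
  Complex.ofRealCLM.compLeftContinuous ℝ X

@[simp]
theorem toComplex_apply {X : Type*} [TopologicalSpace X] (f : C(X, ℝ)) (x : X) :
    toComplex X f x = f x := rfl

theorem norm_toComplex_le {X : Type*} [TopologicalSpace X] [CompactSpace X] (f : C(X, ℝ)) :
    ‖toComplex X f‖ ≤ ‖f‖ :=
  (ContinuousMap.norm_le _ (norm_nonneg f)).2 fun x => by
    rw [toComplex_apply, Complex.norm_real]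
    exact f.norm_coe_le_norm x

theorem star_toComplex {X : Type*} [TopologicalSpace X] (f : C(X, ℝ)) :
    star (toComplex X f) = toComplex X f := by
  ext x
  simp

theorem exists_mul_eq_zero_of_ne {X : Type*} [TopologicalSpace X] [CompactSpace X] [T2Space X]
    {x y : X} (h : x ≠ y) :
    ∃ f g : C(X, ℝ), ‖f‖ ≤ 1 ∧ f x = 1 ∧ g y = 1 ∧ f * g = 0 := by
  obtain ⟨k, hkx, hky, hk⟩ := exists_continuous_zero_one_of_isClosed
    (isClosed_singleton (x := x)) (isClosed_singleton (x := y)) (by simpa using h)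
  refine ⟨⟨fun z => max (1 - 2 * k z) 0, by fun_prop⟩, ⟨fun z => max (2 * k z - 1) 0, by fun_prop⟩,
    (ContinuousMap.norm_le _ zero_le_one).2 fun z => ?_, ?_, ?_, ContinuousMap.ext fun z => ?_⟩
  · change ‖max (1 - 2 * k z) 0‖ ≤ 1
    rw [Real.norm_of_nonneg (le_max_right _ _)]
    exact max_le (by linarith [(hk z).1]) zero_le_one
  · simp [hkx rfl]
  · have : k y = 1 := hky rfl
    norm_num [this]
  · change max (1 - 2 * k z) 0 * max (2 * k z - 1) 0 = 0
    rcases le_total (2 * k z) 1 with hz | hz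
    · rw [max_eq_right (a := 2 * k z - 1) (by linarith), mul_zero]
    · rw [max_eq_right (a := 1 - 2 * k z) (by linarith), zero_mul]

variable {G X A : Type*} [Group G] [TopologicalSpace X] [CompactSpace X] [MulAction G X]
  [ContinuousConstSMul G X] [CStarAlgebra A] (R : CovRep G X A)

namespace CovRep

/-- The state `ψ` restricts to the point mass at `x` on the functions on `X`, which then lie in its
multiplicative domain. -/
structure IsStateAt (R : CovRep G X A) (x : X) (ψ : stateSpace ℂ A) : Prop where
  π_mul (f : C(X, ℂ)) (a : A) : ψ (R.π f * a) = f x * ψ a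
  mul_π (a : A) (f : C(X, ℂ)) : ψ (a * R.π f) = f x * ψ a

variable {R}

theorem exists_apply_ne_zero_and_forall_eq_zero [T2Space X] {x y : X} {ψ : stateSpace ℂ A}
    (h : ∀ f, (ψ (R.π (toComplex X f))).re = f x) (hyx : y ≠ x) :
    ∃ f, (∀ a, ψ (R.π f * a) = 0 ∧ ψ (a * R.π f) = 0) ∧ f y ≠ 0 := by
  obtain ⟨g, f, hg, hgx, hfy, hgf⟩ := exists_mul_eq_zero_of_ne hyx.symm
  have hnorm : ‖R.π (toComplex X g)‖ ≤ 1 :=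
    (NonUnitalStarAlgHom.norm_apply_le R.π _).trans ((norm_toComplex_le g).trans hg)
  have hre : (ψ (R.π (toComplex X g))).re = 1 := (h g).trans hgx
  have hmul : R.π (toComplex X g) * R.π (toComplex X f) = 0 := by
    rw [← map_mul, ← map_zero R.π]
    congr 1
    ext z
    simpa using DFunLike.congr_fun hgf z
  refine ⟨toComplex X f, fun a => ⟨stateSpace.apply_eq_zero_of_star_mul_eq_zero hnorm hre ?_,
    stateSpace.apply_eq_zero_of_mul_star_eq_zero hnorm hre ?_⟩, by simp [hfy]⟩
  · rw [← map_star, star_toComplex, ← mul_assoc, hmul, zero_mul]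
  · rw [star_mul, ← map_star, star_toComplex, ← mul_assoc, hmul, zero_mul]

theorem isStateAt_of_forall_re_eq [T2Space X] {x : X} {ψ : stateSpace ℂ A}
    (h : ∀ f, (ψ (R.π (toComplex X f))).re = f x) : R.IsStateAt x ψ := by
  let I : Ideal C(X, ℂ) :=
    { carrier := {f | ∀ a, ψ (R.π f * a) = 0 ∧ ψ (a * R.π f) = 0}
      zero_mem' := fun a => by simp
      add_mem' := fun {f g} hf hg a => by
        simp only [map_add, add_mul, mul_add, hf a, hg a, add_zero, and_self]
      smul_mem' := fun g f hf a => by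
        constructor
        · rw [smul_eq_mul, mul_comm, map_mul R.π, mul_assoc, (hf _).1]
        · rw [smul_eq_mul, map_mul R.π, ← mul_assoc, (hf _).2] }
  have hI : IsClosed (I : Set C(X, ℂ)) := by
    have hπ : Continuous R.π := map_continuous R.π
    have hψ : Continuous ψ := map_continuous ψ
    change IsClosed {f | ∀ a, ψ (R.π f * a) = 0 ∧ ψ (a * R.π f) = 0}
    simp only [ofPred_forall, ofPred_and]
    exact isClosed_iInter fun a => (isClosed_eq (by fun_prop) continuous_const).inter
      (isClosed_eq (by fun_prop) continuous_const)
  have hsep : ∀ y ≠ x, ∃ f ∈ I, f y ≠ 0 := fun y hyx =>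
    exists_apply_ne_zero_and_forall_eq_zero h hyx
  have hker (f : C(X, ℂ)) : f - algebraMap ℂ _ (f x) ∈ I :=
    mem_of_isClosed_ideal_of_forall_ne hI hsep (by simp)
  constructor
  · intro f a
    have h := (hker f a).1
    rwa [map_sub, AlgHomClass.commutes, sub_mul, map_sub, ← Algebra.smul_def, map_smul, sub_eq_zero,
      smul_eq_mul] at h
  · intro a f
    have h := (hker f a).2
    rwa [map_sub, AlgHomClass.commutes, mul_sub, map_sub, ← Algebra.commutes, ← Algebra.smul_def,
      map_smul, sub_eq_zero, smul_eq_mul] at h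

variable (R)

/-- The probability measure on `X` that is the restriction of a state to the functions on `X`. -/
def restrict (φ : stateSpace ℂ A) : RadonProba X :=
  ⟨StrongDual.toWeakDual (Complex.reCLM ∘L ((φ.1.toStrongDual ∘L
    ⟨R.π.toAlgHom.toLinearMap, map_continuous R.π⟩).restrictScalars ℝ) ∘L toComplex X),
    fun f => (Complex.abs_re_le_norm _).trans <| (stateSpace.norm_apply_le φ _).trans <|
      (NonUnitalStarAlgHom.norm_apply_le R.π _).trans (norm_toComplex_le f), by
    have h : toComplex X 1 = 1 := by ext; simp
    change (φ (R.π (toComplex X 1))).re = 1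
    rw [h, map_one, stateSpace.map_one, Complex.one_re]⟩

@[simp]
theorem restrict_apply (φ : stateSpace ℂ A) (f : C(X, ℝ)) :
    R.restrict φ f = (φ (R.π (toComplex X f))).re := rfl

theorem continuous_restrict : Continuous R.restrict :=
  stateSpace.continuous_of_continuous_eval fun _ =>
    Complex.continuous_re.comp (stateSpace.continuous_eval _)

theorem restrict_conj (s : G) (φ : stateSpace ℂ A) : R.restrict (R.conj s φ) = s • R.restrict φ :=
  DFunLike.ext _ _ fun f => by
    have h : toComplex X (shift s f) = shift s (toComplex X f) := rfl
    rw [RadonProba.smul_apply, restrict_apply, restrict_apply, conj_apply, h, ← R.cov, ← mul_assoc,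
      R.u_inv_mul_self, one_mul]

variable [T2Space X]

theorem exists_isStateAt (hX : IsGBoundary G X) (φ : stateSpace ℂ A) (x : X) :
    ∃ ψ ∈ closure (range fun s => R.conj s φ), R.IsStateAt x ψ := by
  have horbit : MulAction.orbit G (R.restrict φ) = R.restrict '' range fun s => R.conj s φ := by
    rw [← range_comp]
    exact congrArg range (funext fun s => (R.restrict_conj s φ).symm)
  have hx := hX.dirac_mem_closure_orbit (R.restrict φ) x
  rw [horbit, ← image_closure_of_isCompact isClosed_closure.isCompact
    R.continuous_restrict.continuousOn] at hx
  obtain ⟨ψ, hψ, hψx⟩ := hx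
  exact ⟨ψ, hψ, isStateAt_of_forall_re_eq fun f => DFunLike.congr_fun hψx f⟩

variable {R}

theorem IsStateAt.apply_u_eq_zero {x : X} {ψ : stateSpace ℂ A} (h : R.IsStateAt x ψ) {s : G}
    (hs : s • x ≠ x) : ψ (R.u s) = 0 := by
  obtain ⟨f, g, -, hfx, hgx, hfg⟩ := exists_mul_eq_zero_of_ne hs
  have hcov := congrArg ψ (R.cov s (toComplex X g))
  have hg : g (s • x) = 0 := by simpa [hfx] using DFunLike.congr_fun hfg (s • x)
  rw [h.mul_π, h.π_mul, shift_apply, toComplex_apply, toComplex_apply, hg, hgx] at hcov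
  simpa using hcov.symm

theorem IsStateAt.apply_ev {x : X} {ψ : stateSpace ℂ A} (h : R.IsStateAt x ψ) {c : G →₀ C(X, ℂ)}
    (hc : ∀ s ∈ c.support, s ≠ 1 → s • x ≠ x) : ψ (R.ev c) = c 1 x := by
  rw [ev_apply, map_sum, Finset.sum_eq_single 1]
  · rw [h.π_mul, map_one R.u, stateSpace.map_one, mul_one]
  · intro s hs hs1
    rw [h.π_mul, h.apply_u_eq_zero (hc s hs hs1), mul_zero]
  · intro h1
    rw [Finsupp.notMem_support_iff.1 h1, map_zero, zero_mul, map_zero]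

end CovRep

end StatesAtPoints

section SimplicityFromFreeness

theorem eq_top_of_isUnit_mem {A : Type*} [Ring A] {I : TwoSidedIdeal A} {a : A} (ha : a ∈ I)
    (hu : IsUnit a) : I = ⊤ := by
  obtain ⟨b, hb⟩ := hu.exists_left_inv
  refine TwoSidedIdeal.ext fun x => ⟨fun _ => TwoSidedIdeal.mem_top A, fun _ => ?_⟩
  have h := I.mul_mem_left (x * b) a ha
  rwa [mul_assoc, hb, mul_one] at h

theorem exists_stateSpace_forall_mem_eq_zero {A : Type*} [NormedAddCommGroup A] [NormedSpace ℂ A]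
    [One A] [NormOneClass A] {J : Submodule ℂ A} (hJ : ∀ b ∈ J, 1 ≤ ‖1 - b‖) :
    ∃ φ : stateSpace ℂ A, ∀ b ∈ J, φ b = 0 := by
  have hone : ‖J.mkQ 1‖ = 1 := by
    refine le_antisymm ((Submodule.Quotient.norm_mk_le J 1).trans_eq norm_one) ?_
    by_contra! hlt
    obtain ⟨m, hm, hm1⟩ := Submodule.Quotient.norm_mk_lt (J.mkQ 1) (sub_pos.2 hlt)
    rw [add_sub_cancel] at hm1
    have h := hJ (1 - m) ((Submodule.Quotient.eq J).1 hm.symm)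
    rw [sub_sub_cancel] at h
    exact h.not_gt hm1
  obtain ⟨g, hg, hg1⟩ := exists_dual_vector'' ℂ (J.mkQ 1)
  have hbound (a : A) : ‖g (J.mkQ a)‖ ≤ 1 * ‖a‖ :=
    (g.le_of_opNorm_le hg _).trans
      (mul_le_mul_of_nonneg_left (Submodule.Quotient.norm_mk_le J a) zero_le_one)
  refine ⟨⟨StrongDual.toWeakDual (LinearMap.mkContinuous ((g : (A ⧸ J) →ₗ[ℂ] ℂ) ∘ₗ J.mkQ) 1 hbound),
    fun a => (hbound a).trans_eq (one_mul _), hg1.trans (by rw [hone, RCLike.ofReal_one])⟩,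
    fun b hb => ?_⟩
  change g (J.mkQ b) = 0
  rw [Submodule.mkQ_apply, (Submodule.Quotient.mk_eq_zero J).2 hb, map_zero]

theorem exists_stateSpace_forall_mem_ideal_eq_zero {A : Type*} [CStarAlgebra A]
    {S : StarSubalgebra ℂ A} (hS : IsClosed (S : Set A)) {I : TwoSidedIdeal S} (hI : I ≠ ⊤) :
    ∃ φ : stateSpace ℂ A, ∀ a ∈ I, φ (a : A) = 0 := by
  have : Nontrivial A := by
    by_contra h
    rw [not_nontrivial_iff_subsingleton] at h
    exact hI (eq_top_of_isUnit_mem I.zero_mem (isUnit_of_subsingleton 0))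
  have : CompleteSpace S := hS.completeSpace_coe
  let J : Submodule ℂ A := (I.asIdeal.restrictScalars ℂ).map S.subtype.toAlgHom.toLinearMap
  obtain ⟨φ, hφ⟩ := exists_stateSpace_forall_mem_eq_zero (J := J) (by
    rintro _ ⟨a, ha, rfl⟩
    by_contra! hlt
    have hu : IsUnit (1 - (1 - a)) := isUnit_one_sub_of_norm_lt_one hlt
    rw [sub_sub_cancel] at hu
    exact hI (eq_top_of_isUnit_mem (TwoSidedIdeal.mem_asIdeal.1 ha) hu))
  exact ⟨φ, fun a ha => hφ _ ⟨a, TwoSidedIdeal.mem_asIdeal.2 ha, rfl⟩⟩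

variable {G X : Type*} [Group G] [TopologicalSpace X] [CompactSpace X] [T2Space X] [MulAction G X]
  [ContinuousConstSMul G X]

theorem IsTopologicallyFree.dense_setOf_forall_smul_ne (hfree : IsTopologicallyFree G X)
    (F : Finset G) : Dense {x : X | ∀ s ∈ F, s ≠ 1 → s • x ≠ x} := by
  have h := dense_biInter_of_isOpen (S := {s : G | s ∈ F ∧ s ≠ 1})
    (f := fun s => {x : X | s • x ≠ x})
    (fun s _ => isOpen_ne_fun (continuous_const_smul s) continuous_id)
    ((F.finite_toSet.subset fun s hs => hs.1).countable) fun s hs => hfree s hs.2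
  refine h.mono fun x hx s hs hs1 => ?_
  exact mem_iInter₂.1 hx s ⟨hs, hs1⟩

/- On the points that are moved by the support of `c`, the conjugates of `φ` accumulate at a state
that vanishes at `a` and takes the value `c 1 x` at `R.ev c`. -/
theorem CovRep.norm_apply_one_le {A : Type*} [CStarAlgebra A] (hX : IsGBoundary G X)
    (hfree : IsTopologicallyFree G X) (R : CovRep G X A) {φ : stateSpace ℂ A} {a : A}
    (hφ : ∀ s, R.conj s φ a = 0) (c : G →₀ C(X, ℂ)) : ‖c 1‖ ≤ ‖a - R.ev c‖ := by
  have hclosed : IsClosed {x : X | ‖c 1 x‖ ≤ ‖a - R.ev c‖} :=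
    isClosed_le (by fun_prop) continuous_const
  refine (ContinuousMap.norm_le _ (norm_nonneg _)).2 fun x => ?_
  refine hclosed.closure_subset_iff.2 (fun y hy => ?_)
    (hfree.dense_setOf_forall_smul_ne c.support x)
  obtain ⟨ψ, hψ, hψy⟩ := R.exists_isStateAt hX φ y
  have hψa : ψ a = 0 := by
    refine closure_minimal (t := {χ : stateSpace ℂ A | χ a = 0}) ?_
      (isClosed_eq (stateSpace.continuous_eval a) continuous_const) hψ
    rintro _ ⟨s, rfl⟩
    exact hφ s
  calc ‖c 1 y‖ = ‖ψ (a - R.ev c)‖ := by rw [map_sub, hψa, hψy.apply_ev hy, zero_sub, norm_neg]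
    _ ≤ ‖a - R.ev c‖ := stateSpace.norm_apply_le ψ _

section PermRep

variable {ι : Type*} {κ : G →* Equiv.Perm ι} {j : ι → X}
  {hj : ∀ s i, j (κ s i) = s • j i}

theorem isCStarSimple_of_isTopologicallyFree [Nonempty ι] (hX : IsGBoundary G X)
    (hfree : IsTopologicallyFree G X) (hκ : ∀ s i, κ s i = i → s = 1)
    {S : StarSubalgebra ℂ (EllTwo ι →L[ℂ] EllTwo ι)}
    (hS : IsClosed (S : Set (EllTwo ι →L[ℂ] EllTwo ι)))
    (hSR : S ≤ (permRep κ j hj).cstar) (hu : ∀ s, (permRep κ j hj).u s ∈ S) : IsCStarSimple S := by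
  classical
  set R := permRep κ j hj
  refine ⟨⟨1, 0, fun h => one_ne_zero (congrArg Subtype.val h)⟩, fun I _ =>
    or_iff_not_imp_right.2 fun hI => ?_⟩
  obtain ⟨φ, hφ⟩ := exists_stateSpace_forall_mem_ideal_eq_zero hS hI
  have hconj (a : S) (ha : a ∈ I) (s : G) : R.conj s φ (a : EllTwo ι →L[ℂ] EllTwo ι) = 0 :=
    hφ _ (I.mul_mem_left ⟨R.u s⁻¹, hu _⟩ _ (I.mul_mem_right a ⟨R.u s, hu s⟩ ha))
  have hvec (a : S) (ha : a ∈ I) (i : ι) :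
      (a : EllTwo ι →L[ℂ] EllTwo ι) (lp.single 2 i 1) = 0 := by
    have h := inner_single_eq_zero_of_mem_cstar hκ (hSR (star a * a).2)
      (R.norm_apply_one_le hX hfree (hconj (star a * a) (I.mul_mem_left _ _ ha))) i
    change ⟪_, star (a : EllTwo ι →L[ℂ] EllTwo ι) ((a : EllTwo ι →L[ℂ] EllTwo ι) _)⟫_ℂ = 0 at h
    rwa [ContinuousLinearMap.star_eq_adjoint, ContinuousLinearMap.adjoint_inner_right,
      inner_self_eq_zero] at h
  refine le_bot_iff.1 fun a ha => (TwoSidedIdeal.mem_bot _).2 ?_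
  exact Subtype.ext (EllTwo.clm_eq_zero (hvec a ha))

end PermRep

theorem isCStarSimple_reducedGroupCStar (hX : IsGBoundary G X) (hfree : IsTopologicallyFree G X) :
    IsCStarSimple (reducedGroupCStar G) := by
  classical
  obtain ⟨x⟩ := hX.nonempty
  exact isCStarSimple_of_isTopologicallyFree hX hfree (fun s t => mul_eq_right.1)
    (StarSubalgebra.isClosed_topologicalClosure _) (reducedGroupCStar_le x)
    fun s => subset_closure (StarAlgebra.subset_adjoin ℂ _ ⟨s, rfl⟩)

theorem isCStarSimple_reducedCrossedProduct (hX : IsGBoundary G X)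
    (hfree : IsTopologicallyFree G X) : IsCStarSimple (reducedCrossedProduct G X) := by
  classical
  have := hX.nonempty
  rw [reducedCrossedProduct_eq]
  exact isCStarSimple_of_isTopologicallyFree hX hfree
    (fun s p h => mul_eq_right.1 (congrArg Prod.fst h))
    (CovRep.isClosed_cstar _) le_rfl fun s => subset_closure (CovRep.u_mem_alg _ s)

end SimplicityFromFreeness

section EquivariantMeans

variable {G : Type*} [Group G]

theorem memℓp_one_comp_mul_left (s : G) (p : lp (fun _ : G => ℝ) 1) :
    Memℓp (fun t => p (s⁻¹ * t)) 1 :=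
  memℓp_gen <| (Equiv.mulLeft s⁻¹).summable_iff.2 ((lp.memℓp p).summable (by norm_num))

/-- The left translation on `ℓ¹(G)`: `p` is taken to `t ↦ p (s⁻¹ t)`. -/
def translateOne (s : G) : lp (fun _ : G => ℝ) 1 →ₗ[ℝ] lp (fun _ : G => ℝ) 1 where
  toFun p := ⟨fun t => p (s⁻¹ * t), memℓp_one_comp_mul_left s p⟩
  map_add' _ _ := rfl
  map_smul' _ _ := rfl

@[simp]
theorem translateOne_apply (s : G) (p : lp (fun _ : G => ℝ) 1) (t : G) :
    translateOne s p t = p (s⁻¹ * t) := rfl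

theorem translateOne_single [DecidableEq G] (s g : G) (r : ℝ) :
    translateOne s (lp.single 1 g r) = lp.single 1 (s * g) r := by
  ext t
  simp only [translateOne_apply, lp.single_apply, Pi.single_apply, inv_mul_eq_iff_eq_mul]

/-- The probability densities in `ℓ¹(ι)`. -/
def probaDensities (ι : Type*) : Set (lp (fun _ : ι => ℝ) 1) := {p | (∀ i, 0 ≤ p i) ∧ HasSum p 1}

theorem convex_probaDensities {ι : Type*} : Convex ℝ (probaDensities ι) := by
  intro p hp q hq a b ha hb hab
  refine ⟨fun i => add_nonneg (mul_nonneg ha (hp.1 i)) (mul_nonneg hb (hq.1 i)), ?_⟩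
  have h := (hp.2.mul_left a).add (hq.2.mul_left b)
  rwa [mul_one, mul_one, hab] at h

theorem single_mem_probaDensities {ι : Type*} [DecidableEq ι] (i : ι) :
    lp.single 1 i 1 ∈ probaDensities ι := by
  refine ⟨fun k => ?_, hasSum_pi_single i 1⟩
  rw [lp.single_apply, Pi.single_apply]
  split_ifs <;> norm_num

theorem exists_continuousMap_ultrafilter {ι : Type*} {h : ι → ℝ} {C : ℝ} (hC : ∀ i, |h i| ≤ C) :
    ∃ H : C(Ultrafilter ι, ℝ), ∀ i, H (pure i) = h i := by
  let k : ι → Icc (-C) C := fun i => ⟨h i, abs_le.1 (hC i)⟩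
  exact ⟨⟨_, continuous_subtype_val.comp (continuous_ultrafilter_extend k)⟩, fun i =>
    congrArg Subtype.val (congrFun (ultrafilter_extend_extends k) i)⟩

theorem RadonProba.le_sum_of_forall_le {X Z : Type*} [TopologicalSpace Z] [CompactSpace Z]
    [Nonempty Z] (μ : X → RadonProba Z) {a : X →₀ C(Z, ℝ)} {r : ℝ}
    (h : ∀ z : X → Z, r ≤ a.sum fun x f => f (z x)) : r ≤ a.sum fun x f => μ x f := by
  have hmin (x : X) : ∃ z, ∀ y, a x z ≤ a x y := by
    obtain ⟨z, -, hz⟩ := isCompact_univ.exists_isMinOn univ_nonempty (a x).continuous.continuousOn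
    exact ⟨z, fun y => hz (mem_univ y)⟩
  choose z hz using hmin
  refine (h z).trans (Finset.sum_le_sum fun x _ => ?_)
  have hconst := (μ x).mono (f := algebraMap ℝ _ (a x (z x))) (g := a x) (hz x)
  rwa [Algebra.algebraMap_eq_smul_one, map_smul, stateSpace.map_one, smul_eq_mul, mul_one]
    at hconst

theorem RadonProba.le_sum_of_forall_le_of_denseRange {ι X Z : Type*} [TopologicalSpace Z]
    [CompactSpace Z] [Nonempty Z] (μ : X → RadonProba Z) {e : ι → Z} (he : DenseRange e)
    {a : X →₀ C(Z, ℝ)} {r : ℝ} (h : ∀ g : X → ι, r ≤ a.sum fun x f => f (e (g x))) :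
    r ≤ a.sum fun x f => μ x f := by
  have hclosed : IsClosed {z : X → Z | r ≤ a.sum fun x f => f (z x)} :=
    isClosed_le continuous_const (continuous_finsetSum _ fun x _ =>
      (a x).continuous.comp (continuous_apply x))
  refine le_sum_of_forall_le μ fun z => ?_
  refine closure_minimal ?_ hclosed (DenseRange.piMap (fun _ : X => he) z)
  rintro _ ⟨g, rfl⟩
  exact h g

variable {X : Type*} [MulAction G X]

/-- The defect of the equivariance of a family of elements of `ℓ¹(G)`. -/
def equivarianceDefect (F : Finset (G × X)) :
    (X → lp (fun _ : G => ℝ) 1) →ₗ[ℝ] (F → lp (fun _ : G => ℝ) 1) :=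
  LinearMap.pi fun j : F =>
    let value := LinearMap.proj (R := ℝ) (φ := fun _ : X => lp (fun _ : G => ℝ) 1)
    translateOne j.1.1 ∘ₗ value j.1.2 - value (j.1.1 • j.1.2)

theorem equivarianceDefect_apply (F : Finset (G × X)) (p : X → lp (fun _ : G => ℝ) 1) (j : F) :
    equivarianceDefect F p j = translateOne j.1.1 (p j.1.2) - p (j.1.1 • j.1.2) := rfl

theorem equivarianceDefect_single [DecidableEq G] (F : Finset (G × X)) (g : X → G) (j : F) :
    equivarianceDefect F (fun x => lp.single 1 (g x) 1) j =
      lp.single 1 (j.1.1 * g j.1.2) 1 - lp.single 1 (g (j.1.1 • j.1.2)) 1 := by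
  rw [equivarianceDefect_apply, translateOne_single]

/- The functional `f` induces functions `H j` on the Stone–Čech compactification of `G`, whose
translates have the same mean at `x` as the functions themselves at `s x`. -/
theorem HasEquivariantMeans.nonpos_of_forall_le (hX : HasEquivariantMeans G X)
    {F : Finset (G × X)} (f : StrongDual ℝ (F → lp (fun _ : G => ℝ) 1)) {r : ℝ}
    (hf : ∀ p : X → lp (fun _ : G => ℝ) 1, (∀ x, p x ∈ probaDensities G) →
      r ≤ f (equivarianceDefect F p)) : r ≤ 0 := by
  classical
  obtain ⟨m, hm⟩ := hX
  have hbound (j : F) (g : G) : |f (Pi.single j (lp.single 1 g 1))| ≤ ‖f‖ :=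
    f.unit_le_opNorm _ (by rw [Pi.norm_single, lp.norm_single (by norm_num), norm_one])
  choose H hH using fun j => exists_continuousMap_ultrafilter (hbound j)
  let a : X →₀ C(Ultrafilter G, ℝ) := ∑ j : F,
    (Finsupp.single j.1.2 (shift j.1.1 (H j)) - Finsupp.single (j.1.1 • j.1.2) (H j))
  have ha (φ : X → C(Ultrafilter G, ℝ) →ₗ[ℝ] ℝ) : (a.sum fun x h => φ x h) =
      ∑ j : F, (φ j.1.2 (shift j.1.1 (H j)) - φ (j.1.1 • j.1.2) (H j)) := by
    change Finsupp.lsum ℝ φ a = _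
    simp only [a, map_sum, map_sub, Finsupp.lsum_single]
  have hpoint (g : X → G) : r ≤ a.sum fun x h => h (pure (g x)) := by
    refine (hf (fun x => lp.single 1 (g x) 1) fun x => single_mem_probaDensities _).trans_eq ?_
    refine Eq.trans ?_ (ha fun x => (ContinuousMap.evalCLM ℝ (pure (g x))).toLinearMap).symm
    rw [← Finset.univ_sum_single (equivarianceDefect F _), map_sum]
    refine Finset.sum_congr rfl fun j _ => ?_
    rw [equivarianceDefect_single, Pi.single_sub, map_sub, ← hH, ← hH, ← ultrafilter_smul_pure]
    rfl
  have : Nonempty (Ultrafilter G) := ⟨pure 1⟩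
  refine (RadonProba.le_sum_of_forall_le_of_denseRange m denseRange_pure hpoint).trans_eq ?_
  refine (ha fun x => (m x).1.toStrongDual.toLinearMap).trans (Finset.sum_eq_zero fun j _ => ?_)
  change m j.1.2 (shift j.1.1 (H j)) - m (j.1.1 • j.1.2) (H j) = 0
  rw [hm, RadonProba.smul_apply, sub_self]

theorem HasEquivariantMeans.exists_densities (hX : HasEquivariantMeans G X) (F : Finset (G × X))
    {ε : ℝ} (hε : 0 < ε) : ∃ p : X → lp (fun _ : G => ℝ) 1, (∀ x, p x ∈ probaDensities G) ∧
      ∀ j ∈ F, ‖translateOne j.1 (p j.2) - p (j.1 • j.2)‖ < ε := by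
  let P : Set (X → lp (fun _ : G => ℝ) 1) := {p | ∀ x, p x ∈ probaDensities G}
  have hP : Convex ℝ P := fun p hp q hq a b ha hb hab x =>
    convex_probaDensities (hp x) (hq x) ha hb hab
  by_contra! hno
  have hdisj : Disjoint (Metric.ball 0 ε) (equivarianceDefect F '' P) := by
    rw [Set.disjoint_left]
    rintro _ hball ⟨p, hp, rfl⟩
    obtain ⟨j, hj, hle⟩ := hno p hp
    exact (hle.trans (norm_le_pi_norm (equivarianceDefect F p) ⟨j, hj⟩)).not_gt
      (mem_ball_zero_iff.1 hball)
  obtain ⟨f, r, hball, himage⟩ := geometric_hahn_banach_open (convex_ball _ _) Metric.isOpen_ball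
    (hP.linear_image (equivarianceDefect F)) hdisj
  have hr : 0 < r := by simpa using hball 0 (Metric.mem_ball_self hε)
  exact hr.not_ge (hX.nonpos_of_forall_le f fun p hp => himage _ (mem_image_of_mem _ hp))

theorem sq_sqrt_sub_sqrt_le {a b : ℝ} (ha : 0 ≤ a) (hb : 0 ≤ b) : (√a - √b) ^ 2 ≤ |a - b| := by
  have hfactor : a - b = (√a - √b) * (√a + √b) := by
    linear_combination -Real.sq_sqrt ha + Real.sq_sqrt hb
  have hle : |√a - √b| ≤ |√a + √b| :=
    sq_le_sq.1 (by nlinarith [mul_nonneg (Real.sqrt_nonneg a) (Real.sqrt_nonneg b)])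
  rw [hfactor, abs_mul, ← sq_abs, sq]
  gcongr

theorem norm_sq_eq_tsum {ι : Type*} {E : ι → Type*} [∀ i, NormedAddCommGroup (E i)]
    (v : lp E 2) : ‖v‖ ^ 2 = ∑' i, ‖v i‖ ^ 2 := by
  simpa using lp.norm_rpow_eq_tsum (p := 2) (by norm_num) v

theorem summable_norm_sq {ι : Type*} {E : ι → Type*} [∀ i, NormedAddCommGroup (E i)]
    (v : lp E 2) : Summable fun i => ‖v i‖ ^ 2 := by
  simpa using (lp.memℓp v).summable (p := 2) (by norm_num)

theorem norm_sq_ofReal_sqrt {r : ℝ} (hr : 0 ≤ r) : ‖((√r : ℝ) : ℂ)‖ ^ 2 = r := by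
  rw [Complex.norm_real, Real.norm_of_nonneg (Real.sqrt_nonneg _), Real.sq_sqrt hr]

/-- The vector of the square roots of the values of a probability density. -/
def sqrtDensity {ι : Type*} (p : probaDensities ι) : EllTwo ι :=
  ⟨fun i => ((√(p.1 i) : ℝ) : ℂ), memℓp_gen <| by
    simpa only [ENNReal.toReal_ofNat, Real.rpow_ofNat, norm_sq_ofReal_sqrt (p.2.1 _)]
      using p.2.2.summable⟩

theorem norm_sqrtDensity {ι : Type*} (p : probaDensities ι) : ‖sqrtDensity p‖ = 1 := by
  refine (pow_eq_one_iff_of_nonneg (norm_nonneg _) two_ne_zero).1 ?_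
  rw [norm_sq_eq_tsum, ← p.2.2.tsum_eq]
  exact tsum_congr fun i => norm_sq_ofReal_sqrt (p.2.1 i)

theorem norm_leftRegular_sqrtDensity_sub_sq_le (s : G) (p q : probaDensities G) :
    ‖leftRegular G s (sqrtDensity p) - sqrtDensity q‖ ^ 2 ≤ ‖translateOne s p.1 - q.1‖ := by
  have hnorm := lp.norm_rpow_eq_tsum (p := 1) (by norm_num) (translateOne s p.1 - q.1)
  have hsum := (lp.memℓp (translateOne s p.1 - q.1)).summable (p := 1) (by norm_num)
  simp only [ENNReal.toReal_one, Real.rpow_one] at hnorm hsum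
  rw [norm_sq_eq_tsum, hnorm]
  refine (summable_norm_sq _).tsum_le_tsum (fun t => ?_) hsum
  change ‖((√(p.1 (s⁻¹ * t)) : ℝ) : ℂ) - ((√(q.1 t) : ℝ) : ℂ)‖ ^ 2 ≤ |p.1 (s⁻¹ * t) - q.1 t|
  rw [← Complex.ofReal_sub, Complex.norm_real, Real.norm_eq_abs, sq_abs]
  exact sq_sqrt_sub_sqrt_le (p.2.1 _) (q.2.1 _)

/-- The families `ξ i` of unit vectors of `ℓ²(G)` over the `G`-set `X` are asymptotically
equivariant along the filter `l`. -/
structure IsAsymptoticallyEquivariant {I : Type*} (l : Filter I) (ξ : I → X → EllTwo G) :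
    Prop where
  norm_eq_one (i : I) (x : X) : ‖ξ i x‖ = 1
  tendsto (s : G) (x : X) :
    Tendsto (fun i => ‖leftRegular G s (ξ i x) - ξ i (s • x)‖) l (𝓝 0)

theorem HasEquivariantMeans.exists_isAsymptoticallyEquivariant (hX : HasEquivariantMeans G X) :
    ∃ ξ : Finset (G × X) × ℕ → X → EllTwo G, IsAsymptoticallyEquivariant atTop ξ := by
  choose p hp hpF using fun i : Finset (G × X) × ℕ =>
    hX.exists_densities i.1 (Nat.one_div_pos_of_nat (α := ℝ) (n := i.2))
  refine ⟨fun i x => sqrtDensity ⟨p i x, hp i x⟩, fun i x => norm_sqrtDensity _, fun s x => ?_⟩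
  have hlim : Tendsto (fun i : Finset (G × X) × ℕ => √(1 / ((i.2 : ℝ) + 1))) atTop (𝓝 0) := by
    rw [← prod_atTop_atTop_eq, ← Real.sqrt_zero]
    exact (Real.continuous_sqrt.tendsto 0).comp
      (tendsto_one_div_add_atTop_nhds_zero_nat.comp tendsto_snd)
  refine squeeze_zero' (Eventually.of_forall fun i => norm_nonneg _) ?_ hlim
  filter_upwards [eventually_ge_atTop (({(s, x)} : Finset (G × X)), 0)] with i hi
  have hmem : (s, x) ∈ i.1 := hi.1 (Finset.mem_singleton_self _)
  exact Real.le_sqrt_of_sq_le ((norm_leftRegular_sqrtDensity_sub_sq_le s _ _).trans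
    (hpF i _ hmem).le)

end EquivariantMeans

section WeakContainment

theorem memℓp_two_iff {ι : Type*} {E : ι → Type*} [∀ i, NormedAddCommGroup (E i)]
    {v : ∀ i, E i} : Memℓp v 2 ↔ Summable fun i => ‖v i‖ ^ 2 := by
  simpa only [ENNReal.toReal_ofNat, Real.rpow_ofNat] using memℓp_gen_iff (p := 2) (f := v)
    (by norm_num)

section Curry

variable {κ Z : Type*}

theorem EllTwo.summable_norm_sq_swap (ξ : EllTwo (κ × Z)) :
    Summable fun p : Z × κ => ‖ξ (p.2, p.1)‖ ^ 2 :=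
  (Equiv.prodComm Z κ).summable_iff.2 (summable_norm_sq ξ)

/-- The slice `t ↦ ξ (t, z)` of an element of `ℓ²(κ × Z)`. -/
def EllTwo.slice (z : Z) (ξ : EllTwo (κ × Z)) : EllTwo κ :=
  ⟨fun t => ξ (t, z), memℓp_two_iff.2
    ((summable_norm_sq ξ).comp_injective (Prod.mk_left_injective z))⟩

theorem EllTwo.memℓp_slice (ξ : EllTwo (κ × Z)) : Memℓp (fun z => slice z ξ) 2 := by
  refine memℓp_two_iff.2 ?_
  simp only [norm_sq_eq_tsum]
  exact ((summable_prod_of_nonneg fun _ => by positivity).1 ξ.summable_norm_sq_swap).2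

theorem EllTwo.memℓp_uncurry (v : lp (fun _ : Z => EllTwo κ) 2) :
    Memℓp (fun p : κ × Z => v p.2 p.1) 2 := by
  refine memℓp_two_iff.2 ((Equiv.prodComm Z κ).summable_iff.1 ?_)
  change Summable fun p : Z × κ => ‖v p.1 p.2‖ ^ 2
  refine (summable_prod_of_nonneg fun _ => by positivity).2 ⟨fun z => summable_norm_sq (v z), ?_⟩
  simpa only [norm_sq_eq_tsum (v _)] using summable_norm_sq v

variable (κ Z) in
/-- The identification of `ℓ²(κ × Z)` with the Hilbert sum of copies of `ℓ²(κ)` over `Z`. -/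
def EllTwo.curry : EllTwo (κ × Z) ≃ₗᵢ[ℂ] lp (fun _ : Z => EllTwo κ) 2 where
  toFun ξ := ⟨fun z => slice z ξ, ξ.memℓp_slice⟩
  map_add' _ _ := rfl
  map_smul' _ _ := rfl
  invFun v := ⟨fun p => v p.2 p.1, memℓp_uncurry v⟩
  left_inv _ := rfl
  right_inv _ := rfl
  norm_map' ξ := by
    refine (sq_eq_sq₀ (norm_nonneg _) (norm_nonneg _)).1 ?_
    change ‖(⟨fun z => slice z ξ, ξ.memℓp_slice⟩ : lp (fun _ : Z => EllTwo κ) 2)‖ ^ 2 = _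
    rw [norm_sq_eq_tsum, norm_sq_eq_tsum, ← (Equiv.prodComm Z κ).tsum_eq]
    refine (ξ.summable_norm_sq_swap.tsum_prod.trans ?_).symm
    exact tsum_congr fun z => (norm_sq_eq_tsum (slice z ξ)).symm

@[simp]
theorem EllTwo.curry_apply (ξ : EllTwo (κ × Z)) (z : Z) (t : κ) :
    curry κ Z ξ z t = ξ (t, z) := rfl

variable {ξ : Z → EllTwo κ} (hξ : ∀ z, ‖ξ z‖ = 1)

include hξ in
theorem memℓp_smul_of_norm_eq_one (ζ : EllTwo Z) : Memℓp (fun z => ζ z • ξ z) 2 := by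
  simpa only [memℓp_two_iff, norm_smul, hξ, mul_one] using summable_norm_sq ζ

/-- The isometry `ζ ↦ (z ↦ ζ z • ξ z)` that is given by a family `ξ` of unit vectors. -/
def smulIsometry : EllTwo Z →ₗᵢ[ℂ] lp (fun _ : Z => EllTwo κ) 2 where
  toFun ζ := ⟨fun z => ζ z • ξ z, memℓp_smul_of_norm_eq_one hξ ζ⟩
  map_add' ζ η := by
    ext1
    funext z
    exact add_smul (ζ z) (η z) (ξ z)
  map_smul' r ζ := by
    ext1
    funext z
    exact mul_smul r (ζ z) (ξ z)
  norm_map' ζ := by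
    refine (sq_eq_sq₀ (norm_nonneg _) (norm_nonneg _)).1 ?_
    rw [norm_sq_eq_tsum, norm_sq_eq_tsum]
    exact tsum_congr fun z => congrArg (· ^ 2) ((norm_smul _ _).trans (by rw [hξ, mul_one]))

/-- The isometry `ζ ↦ ((t, z) ↦ ζ z * ξ z t)` that is given by a family `ξ` of unit vectors. -/
def tensorIsometry : EllTwo Z →ₗᵢ[ℂ] EllTwo (κ × Z) :=
  (EllTwo.curry κ Z).symm.toLinearIsometry.comp (smulIsometry hξ)

end Curry

variable {G X B : Type*} [Group G] [TopologicalSpace B] [CompactSpace B] [MulAction G B]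
  [ContinuousConstSMul G B]

section Slices

variable (q : X → B)

theorem curry_inducedRep_ev (c : G →₀ C(B, ℂ)) (ξ : EllTwo (G × X)) (z : X) :
    EllTwo.curry G X ((inducedRep G q).ev c ξ) z =
      (regRep G (q z)).ev c (EllTwo.curry G X ξ z) := by
  ext t
  rw [EllTwo.curry_apply, inducedRep_ev_apply, regRep_ev_apply]
  rfl

theorem norm_regRep_ev_le (z : X) (c : G →₀ C(B, ℂ)) :
    ‖(regRep G (q z)).ev c‖ ≤ ‖(inducedRep G q).ev c‖ := by
  classical
  refine ContinuousLinearMap.opNorm_le_bound _ (norm_nonneg _) fun η => ?_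
  set ξ := (EllTwo.curry G X).symm (lp.single 2 z η)
  have hslice : EllTwo.curry G X ξ z = η := by
    rw [LinearIsometryEquiv.apply_symm_apply, lp.single_apply_self]
  calc ‖(regRep G (q z)).ev c η‖ = ‖EllTwo.curry G X ((inducedRep G q).ev c ξ) z‖ := by
        rw [curry_inducedRep_ev, hslice]
    _ ≤ ‖EllTwo.curry G X ((inducedRep G q).ev c ξ)‖ := lp.norm_apply_le_norm two_ne_zero _ z
    _ ≤ ‖(inducedRep G q).ev c‖ * ‖ξ‖ := by
        rw [LinearIsometryEquiv.norm_map]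
        exact ContinuousLinearMap.le_opNorm _ _
    _ = ‖(inducedRep G q).ev c‖ * ‖η‖ := by
        rw [LinearIsometryEquiv.norm_map, lp.norm_single two_pos]

theorem norm_inducedRep_ev_le {c : G →₀ C(B, ℂ)} {C : ℝ} (hC0 : 0 ≤ C)
    (hC : ∀ z, ‖(regRep G (q z)).ev c‖ ≤ C) : ‖(inducedRep G q).ev c‖ ≤ C := by
  refine ContinuousLinearMap.opNorm_le_bound _ hC0 fun ξ => ?_
  rw [← (EllTwo.curry G X).norm_map, ← (EllTwo.curry G X).norm_map ξ]
  calc ‖EllTwo.curry G X ((inducedRep G q).ev c ξ)‖ ≤ ‖(C : ℂ) • EllTwo.curry G X ξ‖ := by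
        refine lp.norm_mono two_ne_zero fun z => ?_
        rw [curry_inducedRep_ev, lp.coeFn_smul, Pi.smul_apply, norm_smul, Complex.norm_real,
          Real.norm_of_nonneg hC0]
        exact ContinuousLinearMap.le_of_opNorm_le _ (hC z) _
    _ = C * ‖EllTwo.curry G X ξ‖ := by
        rw [norm_smul, Complex.norm_real, Real.norm_of_nonneg hC0]

end Slices

variable [MulAction G X] {q : X → B} (hq : ∀ (s : G) x, q (s • x) = s • q x)

/-- The covariant representation on `ℓ²(X)` that is given by the action on `X` and an equivariant
map from `X`. -/
def orbitRep : CovRep G B (EllTwo X →L[ℂ] EllTwo X) :=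
  permRep (MulAction.toPermHom G X) q hq

/-- The tensor product of the left regular representation and `orbitRep`, on `ℓ²(G × X)`. -/
def diagonalRep : CovRep G B (EllTwo (G × X) →L[ℂ] EllTwo (G × X)) :=
  permRep (MulAction.toPermHom G (G × X)) (q ∘ Prod.snd) fun s p => hq s p.2

theorem diagonalRep_ev_apply (c : G →₀ C(B, ℂ)) (ξ : EllTwo (G × X)) (p : G × X) :
    (diagonalRep hq).ev c ξ p = ∑ s ∈ c.support, c s (q p.2) * ξ (s⁻¹ • p) :=
  permRep_ev_apply _ _ _ c ξ p

/- Fell's absorption principle: the unitary `(t, z) ↦ (t, t z)` takes one representation to the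
other. -/
theorem norm_diagonalRep_ev (c : G →₀ C(B, ℂ)) :
    ‖(diagonalRep hq).ev c‖ = ‖(inducedRep G q).ev c‖ := by
  let e : Equiv.Perm (G × X) := Equiv.prodShear (Equiv.refl G) MulAction.toPerm
  have hintertwine : permOp e * (inducedRep G q).ev c = (diagonalRep hq).ev c * permOp e := by
    ext ξ p
    rw [mul_apply_eq_comp, mul_apply_eq_comp, permOp_apply, inducedRep_ev_apply,
      diagonalRep_ev_apply]
    refine Finset.sum_congr rfl fun s _ => ?_
    change c s (p.1 • q (p.1⁻¹ • p.2)) * ξ (s⁻¹ * p.1, p.1⁻¹ • p.2) =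
      c s (q p.2) * ξ (s⁻¹ * p.1, (s⁻¹ * p.1)⁻¹ • s⁻¹ • p.2)
    rw [hq, smul_inv_smul, smul_smul, mul_inv_rev, mul_assoc, inv_mul_cancel, mul_one]
  rw [← CStarRing.norm_mul_mem_unitary _ (permOp_mem_unitary e), ← hintertwine,
    CStarRing.norm_mem_unitary_mul _ (permOp_mem_unitary e)]

section Limit

variable {I : Type*} {l : Filter I} {ξ : I → X → EllTwo G}

/- The slice of the difference at `y` is `η y • (λ_s (ξ i (s⁻¹ y)) - ξ i y)` with `η = u s ζ`. -/
theorem IsAsymptoticallyEquivariant.tendsto_norm_u_sub (h : IsAsymptoticallyEquivariant l ξ)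
    (s : G) (ζ : EllTwo X) :
    Tendsto (fun i =>
      ‖(diagonalRep hq).u s (tensorIsometry (h.norm_eq_one i) ζ) -
        tensorIsometry (h.norm_eq_one i) ((orbitRep hq).u s ζ)‖)
      l (𝓝 0) := by
  set η := (orbitRep hq).u s ζ
  set d : I → X → ℝ := fun i y => ‖leftRegular G s (ξ i (s⁻¹ • y)) - ξ i y‖
  have hd (y : X) : Tendsto (fun i => d i y) l (𝓝 0) := by
    simpa only [smul_inv_smul] using h.tendsto s (s⁻¹ • y)
  have hd2 (i : I) (y : X) : d i y ≤ 2 := by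
    refine (norm_sub_le _ _).trans_eq ?_
    rw [leftRegular, ContinuousLinearMap.norm_map_of_mem_unitary (permOp_mem_unitary _),
      h.norm_eq_one, h.norm_eq_one, one_add_one_eq_two]
  have hnorm (i : I) :
      ‖(diagonalRep hq).u s (tensorIsometry (h.norm_eq_one i) ζ) -
        tensorIsometry (h.norm_eq_one i) η‖ ^ 2 =
      ∑' y, ‖η y‖ ^ 2 * d i y ^ 2 := by
    rw [← (EllTwo.curry G X).norm_map, norm_sq_eq_tsum]
    refine tsum_congr fun y => ?_
    rw [← mul_pow, ← norm_smul]
    congr 2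
    ext t
    change ζ (s⁻¹ • y) * ξ i (s⁻¹ • y) (s⁻¹ * t) - η y * ξ i y t =
      η y * (ξ i (s⁻¹ • y) (s⁻¹ * t) - ξ i y t)
    rw [mul_sub]
    rfl
  have hlim : Tendsto (fun i => ∑' y, ‖η y‖ ^ 2 * d i y ^ 2) l (𝓝 (∑' _ : X, 0)) := by
    refine tendsto_tsum_of_dominated_convergence ((summable_norm_sq η).mul_right (2 ^ 2))
      (fun y => ?_) (Eventually.of_forall fun i y => ?_)
    · simpa using ((hd y).pow 2).const_mul (‖η y‖ ^ 2)
    · rw [Real.norm_of_nonneg (by positivity)]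
      gcongr
      exact hd2 i y
  rw [tsum_zero] at hlim
  simp only [← hnorm] at hlim
  simpa using hlim.sqrt

theorem IsAsymptoticallyEquivariant.norm_orbitRep_ev_le [l.NeBot]
    (h : IsAsymptoticallyEquivariant l ξ) (c : G →₀ C(B, ℂ)) :
    ‖(orbitRep hq).ev c‖ ≤ ‖(inducedRep G q).ev c‖ := by
  refine ContinuousLinearMap.opNorm_le_bound _ (norm_nonneg _) fun ζ => ?_
  let V (i : I) := tensorIsometry (κ := G) (h.norm_eq_one i)
  have hπ (i : I) (f : C(B, ℂ)) (η : EllTwo X) :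
      V i ((orbitRep hq).π f η) = (diagonalRep hq).π f (V i η) := by
    ext p
    exact mul_assoc _ _ _
  have hdiff (i : I) : (diagonalRep hq).ev c (V i ζ) - V i ((orbitRep hq).ev c ζ) =
      ∑ s ∈ c.support, (diagonalRep hq).π (c s)
        ((diagonalRep hq).u s (V i ζ) - V i ((orbitRep hq).u s ζ)) := by
    simp only [CovRep.ev_apply, sum_apply, mul_apply_eq_comp, map_sum, hπ, map_sub,
      Finset.sum_sub_distrib]
  have hlim : Tendsto (fun i => ∑ s ∈ c.support, ‖(diagonalRep hq).π (c s)‖ *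
      ‖(diagonalRep hq).u s (V i ζ) - V i ((orbitRep hq).u s ζ)‖) l (𝓝 0) := by
    simpa using tendsto_finsetSum c.support fun s _ =>
      (h.tendsto_norm_u_sub hq s ζ).const_mul ‖(diagonalRep hq).π (c s)‖
  refine ge_of_tendsto' (by simpa using hlim.add_const (‖(inducedRep G q).ev c‖ * ‖ζ‖)) fun i => ?_
  rw [← norm_diagonalRep_ev hq, ← (V i).norm_map ζ, ← (V i).norm_map]
  refine (norm_le_norm_sub_add _ ((diagonalRep hq).ev c (V i ζ))).trans
    (add_le_add ?_ (ContinuousLinearMap.le_opNorm _ _))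
  rw [norm_sub_rev, hdiff]
  exact norm_sum_le_of_le _ fun s _ => ContinuousLinearMap.le_opNorm _ _

end Limit

theorem HasEquivariantMeans.norm_orbitRep_ev_le (hX : HasEquivariantMeans G X)
    (c : G →₀ C(B, ℂ)) : ‖(orbitRep hq).ev c‖ ≤ ‖(inducedRep G q).ev c‖ := by
  classical
  obtain ⟨ξ, hξ⟩ := hX.exists_isAsymptoticallyEquivariant
  exact hξ.norm_orbitRep_ev_le hq c

end WeakContainment

section SimplicityImpliesFreeness

theorem IsCStarSimple.norm_map {A A' : Type*} [CStarAlgebra A] [CStarAlgebra A'] [Nontrivial A']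
    (hA : IsCStarSimple A) (Φ : A →⋆ₐ[ℂ] A') (a : A) : ‖Φ a‖ = ‖a‖ := by
  refine NonUnitalStarAlgHom.norm_map Φ ((injective_iff_map_eq_zero Φ).2 fun b hb => ?_) a
  have hclosed : IsClosed (TwoSidedIdeal.ker Φ : Set A) := by
    have hker : (TwoSidedIdeal.ker Φ : Set A) = Φ ⁻¹' {0} :=
      ext fun _ => TwoSidedIdeal.mem_ker Φ
    rw [hker]
    exact isClosed_singleton.preimage (map_continuous Φ)
  have hbot : TwoSidedIdeal.ker Φ = ⊥ := by
    refine (hA.2 _ hclosed).resolve_right fun htop => ?_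
    have hone : (1 : A) ∈ TwoSidedIdeal.ker Φ := htop ▸ TwoSidedIdeal.mem_top A
    rw [TwoSidedIdeal.mem_ker, map_one] at hone
    exact one_ne_zero hone
  rwa [← TwoSidedIdeal.mem_ker, hbot, TwoSidedIdeal.mem_bot] at hb

section

variable {G B A A' : Type*} [Group G] [TopologicalSpace B] [MulAction G B]
  [ContinuousConstSMul G B] [CStarAlgebra A] [CStarAlgebra A'] {R : CovRep G B A}
  {R' : CovRep G B A'}

/- The closure of the graph of `R.ev c ↦ R'.ev c` in `A × A'` is the graph of the desired map. -/
theorem CovRep.exists_starAlgHom_of_norm_ev_le (h : ∀ c, ‖R'.ev c‖ ≤ ‖R.ev c‖) :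
    ∃ Φ : R.cstar →⋆ₐ[ℂ] A', ∀ c, Φ ⟨R.ev c, R.ev_mem_cstar c⟩ = R'.ev c := by
  set D := (R.prod R').cstar
  have hD : IsClosed (D : Set (A × A')) := (R.prod R').isClosed_cstar
  have hnorm (d : A × A') (hd : d ∈ D) : ‖d.2‖ ≤ ‖d.1‖ := by
    have hclosed : IsClosed {d : A × A' | ‖d.2‖ ≤ ‖d.1‖} :=
      isClosed_le continuous_snd.norm continuous_fst.norm
    refine hclosed.closure_subset_iff.2 ?_ hd
    rintro _ ⟨c, rfl⟩
    rw [prod_ev]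
    exact h c
  let f : D →⋆ₐ[ℂ] A := (StarAlgHom.fst ℂ A A').comp D.subtype
  have hf : Isometry f := AddMonoidHomClass.isometry_of_norm f fun d =>
    (max_eq_left (hnorm d.1 d.2)).symm
  have hev (c : G →₀ C(B, ℂ)) : f ⟨(R.prod R').ev c, ev_mem_cstar _ c⟩ = R.ev c :=
    congrArg Prod.fst (R.prod_ev R' c)
  have hle : R.cstar ≤ f.range := by
    refine StarSubalgebra.topologicalClosure_minimal ?_ hf.isClosedEmbedding.isClosed_range
    rintro _ ⟨c, rfl⟩
    exact ⟨_, hev c⟩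
  let e := StarAlgEquiv.ofInjective f hf.injective
  refine ⟨(StarAlgHom.snd ℂ A A').comp (D.subtype.comp
    ((e.symm : f.range →⋆ₐ[ℂ] D).comp (StarSubalgebra.inclusion hle))), fun c => ?_⟩
  have he : e.symm ⟨R.ev c, hle (R.ev_mem_cstar c)⟩ =
      ⟨(R.prod R').ev c, ev_mem_cstar _ c⟩ :=
    e.symm_apply_eq.2 (Subtype.ext (hev c).symm)
  exact (congrArg (fun d : D => d.1.2) he).trans (congrArg Prod.snd (R.prod_ev R' c))

theorem CovRep.norm_ev_eq_of_isCStarSimple [Nontrivial A'] (hs : IsCStarSimple R.cstar)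
    (h : ∀ c, ‖R'.ev c‖ ≤ ‖R.ev c‖) (c : G →₀ C(B, ℂ)) : ‖R'.ev c‖ = ‖R.ev c‖ := by
  have : IsClosed (R.cstar : Set A) := R.isClosed_cstar
  obtain ⟨Φ, hΦ⟩ := exists_starAlgHom_of_norm_ev_le h
  rw [← hΦ]
  exact hs.norm_map Φ _

theorem CovRep.exists_stateSpace_apply_u_eq_zero [Nontrivial A] {b : B}
    (h : ∀ c, ‖c 1 b‖ ≤ ‖R.ev c‖) : ∃ φ : stateSpace ℂ A, ∀ s, s ≠ 1 → φ (R.u s) = 0 := by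
  let l : (G →₀ C(B, ℂ)) →ₗ[ℂ] ℂ :=
    (ContinuousMap.evalAlgHom ℂ ℂ b).toLinearMap ∘ₗ Finsupp.lapply 1
  have hone : R.ev (Finsupp.single 1 1) = 1 := by rw [ev_single, map_one, map_one, mul_one]
  have hker (a : A) (ha : a ∈ (LinearMap.ker l).map R.ev) : 1 ≤ ‖1 - a‖ := by
    obtain ⟨c, hc, rfl⟩ := ha
    have hc' : c 1 b = 0 := hc
    have hcoeff := h (Finsupp.single 1 1 - c)
    rwa [map_sub R.ev, hone, Finsupp.sub_apply, Finsupp.single_eq_same, ContinuousMap.sub_apply,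
      hc', ContinuousMap.one_apply, sub_zero, norm_one] at hcoeff
  obtain ⟨φ, hφ⟩ := exists_stateSpace_forall_mem_eq_zero hker
  refine ⟨φ, fun s hs => hφ _ ⟨Finsupp.single s 1, ?_, by rw [ev_single, map_one, one_mul]⟩⟩
  change Finsupp.single s (1 : C(B, ℂ)) 1 b = 0
  rw [Finsupp.single_eq_of_ne hs.symm, ContinuousMap.zero_apply]

end

theorem exists_isOpen_forall_of_not_dense {X : Type*} [TopologicalSpace X] {p : X → Prop}
    (h : ¬ Dense {x | ¬ p x}) : ∃ U : Set X, IsOpen U ∧ U.Nonempty ∧ ∀ x ∈ U, p x := by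
  refine ⟨interior {x | p x}, isOpen_interior, ?_, fun _ hx => interior_subset hx⟩
  rw [nonempty_iff_ne_empty, Ne, interior_eq_empty_iff_dense_compl]
  exact h

theorem IsTopologicallyFree.of_surjective {G X B : Type*} [Group G] [TopologicalSpace X]
    [CompactSpace X] [MulAction G X] [ContinuousConstSMul G X] [MulAction.IsMinimal G X]
    [TopologicalSpace B] [CompactSpace B] [T2Space B] [Nonempty B] [MulAction G B]
    [ContinuousConstSMul G B] (hB : IsTopologicallyFree G B) {q : X → B}
    (hq : Function.Surjective q) (hequiv : ∀ (s : G) x, q (s • x) = s • q x) :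
    IsTopologicallyFree G X := by
  intro s hs
  by_contra hdense
  obtain ⟨U, hU, hne, hfix⟩ := exists_isOpen_forall_of_not_dense hdense
  obtain ⟨I, hI⟩ := isCompact_univ.exists_finite_cover_smul G hU hne
  have hfree : Dense (⋂ g ∈ (I : Set G), {b : B | (g * s * g⁻¹) • b ≠ b}) :=
    dense_biInter_of_isOpen
      (fun g _ => isOpen_ne_fun (continuous_const_smul (g * s * g⁻¹)) continuous_id)
      I.countable_toSet fun g _ => hB _ fun h => hs (conj_eq_one_iff.1 h)
  obtain ⟨b, hb⟩ := hfree.nonempty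
  obtain ⟨x, rfl⟩ := hq b
  obtain ⟨g, hg, y, hy, rfl⟩ := mem_iUnion₂.1 (hI (mem_univ x))
  refine mem_iInter₂.1 hb g hg ?_
  change (g * s * g⁻¹) • q (g • y) = q (g • y)
  rw [← hequiv, mul_smul, inv_smul_smul, mul_smul, hfix y hy]

section

variable {G X : Type*} [Group G] [TopologicalSpace X] [CompactSpace X] [T2Space X]
  [MulAction G X] [ContinuousConstSMul G X]

/- A state at `x` takes the value `1` on `π f` if `f x = 1`, and `π f * u s = π f` if `f` is
supported in the set of the fixed points of `s`. -/
theorem isTopologicallyFree_of_apply_permOp_eq_zero (hX : IsGBoundary G X)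
    {φ : stateSpace ℂ (EllTwo X →L[ℂ] EllTwo X)}
    (hφ : ∀ s : G, s ≠ 1 → φ (permOp (MulAction.toPerm s)) = 0) : IsTopologicallyFree G X := by
  intro s hs
  by_contra hdense
  obtain ⟨U, hU, ⟨x, hx⟩, hfix⟩ := exists_isOpen_forall_of_not_dense hdense
  let R : CovRep G X (EllTwo X →L[ℂ] EllTwo X) := orbitRep (q := id) fun _ _ => rfl
  obtain ⟨ψ, hψ, hψx⟩ := R.exists_isStateAt hX φ x
  have hψs : ψ (R.u s) = 0 := by
    have hclosed : IsClosed {ψ : stateSpace ℂ (EllTwo X →L[ℂ] EllTwo X) | ψ (R.u s) = 0} :=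
      isClosed_eq (stateSpace.continuous_eval _) continuous_const
    refine hclosed.closure_subset_iff.2 ?_ hψ
    rintro _ ⟨t, rfl⟩
    change R.conj t φ (R.u s) = 0
    rw [CovRep.conj_apply, ← map_mul, ← map_mul]
    refine hφ _ fun h => hs ?_
    rwa [← mul_assoc, mul_eq_one_iff_eq_inv, mul_eq_left] at h
  obtain ⟨f, hf0, hf1, -⟩ := exists_continuous_zero_one_of_isClosed hU.isClosed_compl
    (isClosed_singleton (x := x)) (by simpa using hx)
  have hπ : R.π (toComplex X f) * R.u s = R.π (toComplex X f) := by
    ext ξ y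
    change (f y : ℂ) * ξ (s⁻¹ • y) = (f y : ℂ) * ξ y
    by_cases hy : y ∈ U
    · rw [inv_smul_eq_iff.2 (hfix y hy).symm]
    · rw [hf0 hy, Pi.zero_apply, Complex.ofReal_zero, zero_mul, zero_mul]
  have hone := hψx.π_mul (toComplex X f) 1
  rw [mul_one, ← hπ, hψx.π_mul, hψs, stateSpace.map_one, toComplex_apply,
    hf1 (mem_singleton x)] at hone
  simp at hone

variable {B A : Type*} [TopologicalSpace B] [CompactSpace B] [MulAction G B]
  [ContinuousConstSMul G B] [CStarAlgebra A] {R : CovRep G B A} {q : X → B}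

theorem isTopologicallyFree_of_isCStarSimple (hX : IsGBoundary G X)
    (hmeans : HasEquivariantMeans G X) (hq : ∀ (s : G) x, q (s • x) = s • q x)
    (hR : ∀ z c, ‖(regRep G (q z)).ev c‖ ≤ ‖R.ev c‖) (hs : IsCStarSimple R.cstar) :
    IsTopologicallyFree G X := by
  classical
  have := hX.nonempty
  obtain ⟨x⟩ := hX.nonempty
  have hle (c : G →₀ C(B, ℂ)) : ‖(orbitRep hq).ev c‖ ≤ ‖R.ev c‖ :=
    (hmeans.norm_orbitRep_ev_le hq c).trans
      (norm_inducedRep_ev_le q (norm_nonneg _) fun z => hR z c)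
  have hcoeff (c : G →₀ C(B, ℂ)) : ‖c 1 (q x)‖ ≤ ‖(orbitRep hq).ev c‖ := by
    rw [CovRep.norm_ev_eq_of_isCStarSimple hs hle, ← one_smul G (q x)]
    exact (norm_apply_one_le_norm_permRep_ev (fun s t => mul_eq_right.1) c 1).trans (hR x c)
  obtain ⟨φ, hφ⟩ := CovRep.exists_stateSpace_apply_u_eq_zero hcoeff
  exact isTopologicallyFree_of_apply_permOp_eq_zero hX hφ

theorem isTopologicallyFree_of_isCStarSimple_reducedGroupCStar (hX : IsGBoundary G X)
    (hmeans : HasEquivariantMeans G X) (hs : IsCStarSimple (reducedGroupCStar G)) :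
    IsTopologicallyFree G X := by
  rw [reducedGroupCStar_eq (PUnit.unit : PUnit.{1})] at hs
  exact isTopologicallyFree_of_isCStarSimple hX hmeans (q := fun _ => PUnit.unit)
    (fun _ _ => rfl) (fun _ _ => le_rfl) hs

theorem isTopologicallyFree_of_isCStarSimple_reducedCrossedProduct (hX : IsGBoundary G X)
    (hmeans : HasEquivariantMeans G X) (hq : ∀ (s : G) x, q (s • x) = s • q x)
    (hs : IsCStarSimple (reducedCrossedProduct G B)) : IsTopologicallyFree G X := by
  rw [reducedCrossedProduct_eq] at hs
  exact isTopologicallyFree_of_isCStarSimple hX hmeans hq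
    (fun z c => norm_regRep_ev_le id (q z) c) hs

end

end SimplicityImpliesFreeness

end

theorem mainTheorem1 (G : Type u) [Group G] :
    (∃ (X : Type u) (_ : TopologicalSpace X) (_ : CompactSpace X) (_ : T2Space X)
      (_ : MulAction G X) (_ : ContinuousConstSMul G X), IsFurstenbergBoundary G X) ∧
    ∀ (X : Type u) [TopologicalSpace X] [CompactSpace X] [T2Space X] [MulAction G X]
      [ContinuousConstSMul G X], IsFurstenbergBoundary G X →
      List.TFAE [
        IsCStarSimple (reducedGroupCStar G),
        IsCStarSimple (reducedCrossedProduct G X),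
        ∃ (B : Type u) (_ : TopologicalSpace B) (_ : CompactSpace B) (_ : T2Space B)
          (_ : MulAction G B) (_ : ContinuousConstSMul G B),
          IsGBoundary G B ∧ IsCStarSimple (reducedCrossedProduct G B),
        IsTopologicallyFree G X,
        ∃ (B : Type u) (_ : TopologicalSpace B) (_ : CompactSpace B) (_ : T2Space B)
          (_ : MulAction G B) (_ : ContinuousConstSMul G B),
          IsGBoundary G B ∧ IsTopologicallyFree G B] := by
  obtain ⟨X₀, _, _, _, _, _, hX₀, -⟩ := exists_isFurstenbergBoundary_hasEquivariantMeans G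
  refine ⟨⟨X₀, _, ‹_›, ‹_›, _, ‹_›, hX₀⟩, fun X _ _ _ _ _ hX => ?_⟩
  have hbd := hX.isGBoundary
  have hmin : MulAction.IsMinimal G X := hbd.minimal
  have hmeans := hX.hasEquivariantMeans
  tfae_have 1 → 4 := isTopologicallyFree_of_isCStarSimple_reducedGroupCStar hbd hmeans
  tfae_have 4 → 1 := fun h => isCStarSimple_reducedGroupCStar hbd h
  tfae_have 4 → 2 := fun h => isCStarSimple_reducedCrossedProduct hbd h
  tfae_have 2 → 3 := fun h => ⟨X, _, ‹_›, ‹_›, _, ‹_›, hbd, h⟩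
  tfae_have 3 → 4 := by
    rintro ⟨B, _, _, _, _, _, hB, h⟩
    obtain ⟨q, -, -, hq⟩ := hX.universal B hB
    exact isTopologicallyFree_of_isCStarSimple_reducedCrossedProduct hbd hmeans hq h
  tfae_have 4 → 5 := fun h => ⟨X, _, ‹_›, ‹_›, _, ‹_›, hbd, h⟩
  tfae_have 5 → 4 := by
    rintro ⟨B, _, _, _, _, _, hB, h⟩
    obtain ⟨q, -, hsurj, hq⟩ := hX.universal B hB
    have : Nonempty B := hB.nonempty
    exact h.of_surjective hsurj hq
  tfae_finish
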